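/- Let $d\ge 1$ and $n\ge 1$ be integers. Let $\mathcal C=\mathcal C_{d,n}\subset\mathbb Z^d$ be the union of the right half-lattice $\mathbb Z^d_{n,+}=\{x\in\mathbb Z^d: x_1\ge n\}$, the left half-lattice $\mathbb Z^d_{-n,-}=\{x\in\mathbb Z^d: x_1\le -n\}$ and the channel $C_n=\{x\in\mathbb Z^d: |x_i|\le n,\ i=1,\dots,d\}$. Write $x\sim y$ when $x,y\in\mathcal C$ are nearest neighbours in $\mathbb Z^d$. Let $X$ be the continuous-time random walk on $\mathcal C$ that jumps at rate $1$ to each nearest neighbour in $\mathcal C$, with law $\mathbb P_x$ when started from $x$; its generator is $G\psi(x)=\sum_{y\in\mathcal C,\,y\sim x}[\psi(y)-\psi(x)]$, and $\psi:\mathcal C\to\mathbb R$ is called harmonic if $G\psi(x)=0$ for all $x\in\mathcal C$. The walk is said to be definitively in a set $A$ if there is a finite $T>0$ such that $X(t)\in A$ for all $t\ge T$. Set $p_x^{\pm}=\mathbb P_x(X \text{ is definitively in } \mathbb Z^d_{\pm n,\pm})$. Fix real numbers $\lambda^-<\lambda^+$ and let $$\lambda_x=\lambda^-p_x^-+\lambda^+p_x^+,\qquad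 x\in\mathcal C .$$ For $|\xi|\le n$ let $\Sigma_\xi=\{x\in C_n: x_1=\xi\}$, and define the flux $I_\xi(\psi)=\sum_{x\in\Sigma_\xi}\big(\psi(x-e_1)-\psi(x)\big)$, where $e_1$ is the unit vector in the first coordinate direction. Then: 1. $\lambda$ is a bounded harmonic function on $\mathcal C$. 2. If $d\ge3$, then $p_x^++p_x^-=1$ for every $x\in\mathcal C$, and $\lambda$ is non-constant. 3. $I_\xi(\lambda)$ has the same value for all integers $\xi$ with $|\xi|<n$. Moreover there is a constant $c>0$, depending only on $d,\lambda^-,\lambda^+$ (and not on $n$), such that for all $n\ge1$ and all integers $\xi$ with $|\xi|<n$, $$\frac{|I_\xi(\lambda)|}{n^{d-1}}\le\frac cn .$$ -/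

import Mathlib

open MeasureTheory ProbabilityTheory

namespace ChannelWalk

noncomputable section

/-- The right half-lattice `{x ∈ ℤ^d : x₁ ≥ n}`. Coordinate `0 : Fin d` is `x₁`. -/
def rightHalf (d n : ℕ) [NeZero d] : Set (Fin d → ℤ) := {x | (n : ℤ) ≤ x 0}

/-- The left half-lattice `{x ∈ ℤ^d : x₁ ≤ -n}`. -/
def leftHalf (d n : ℕ) [NeZero d] : Set (Fin d → ℤ) := {x | x 0 ≤ -(n : ℤ)}

/-- The channel `C_n = {x ∈ ℤ^d : |x_i| ≤ n for all i}`. -/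
def channel (d n : ℕ) : Set (Fin d → ℤ) := {x | ∀ i, |x i| ≤ (n : ℤ)}

/-- The infinite-volume domain: two half-lattices joined by the channel. -/
def domain (d n : ℕ) [NeZero d] : Set (Fin d → ℤ) :=
  rightHalf d n ∪ channel d n ∪ leftHalf d n

/-- Nearest neighbours of `ℤ^d`. -/
def Neighbor {d : ℕ} (x y : Fin d → ℤ) : Prop := ∑ i, |x i - y i| = 1

/-- The generator `G ψ (x) = ∑_{y ∈ domain, y ∼ x} (ψ y - ψ x)`. -/
def generator {d n : ℕ} [NeZero d] (ψ : domain d n → ℝ) (x : domain d n) : ℝ :=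
  ∑ᶠ y ∈ {y : domain d n | Neighbor (y : Fin d → ℤ) (x : Fin d → ℤ)}, (ψ y - ψ x)

def IsHarmonic {d n : ℕ} [NeZero d] (ψ : domain d n → ℝ) : Prop := ∀ x, generator ψ x = 0

/-- The `2 d` signed directions: `(i, true)` is `+e_i`, `(i, false)` is `-e_i`. -/
abbrev Direction (d : ℕ) : Type := Fin d × Bool

def Direction.vec {d : ℕ} (e : Direction d) : Fin d → ℤ :=
  Pi.single e.1 (if e.2 then 1 else -1)

open Classical in
/-- Attempted jump in direction `e`, suppressed if it would leave the domain. -/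
def move {d n : ℕ} [NeZero d] (x : domain d n) (e : Direction d) : domain d n :=
  if h : (x : Fin d → ℤ) + e.vec ∈ domain d n then ⟨x + e.vec, h⟩ else x

/-- Sample points: for each ring `k = 0, 1, 2, …` of the clock, the direction attempted at that
ring and the waiting time that precedes it. -/
abbrev Sample (d : ℕ) : Type := ℕ → Direction d × ℝ

/-- Directions uniform on the `2 d` possibilities, waiting times exponential of rate `2 d`,
everything independent. Equivalently, each of the `2 d` directions has its own independent
rate-one Poisson clock. -/
def sampleMeasure (d : ℕ) : Measure (Sample d) :=
  Measure.infinitePi fun _ : ℕ =>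
    (uniformOn (Set.univ : Set (Direction d))).prod (expMeasure (2 * (d : ℝ)))

instance sampleMeasure_isProbabilityMeasure (d : ℕ) [NeZero d] :
    IsProbabilityMeasure (sampleMeasure d) := by
  have h : IsProbabilityMeasure (expMeasure (2 * (d : ℝ))) :=
    isProbabilityMeasure_expMeasure (by
      have := Nat.pos_of_ne_zero (NeZero.ne d); positivity)
  have h' : IsProbabilityMeasure (uniformOn (Set.univ : Set (Direction d))) :=
    isProbabilityMeasure_uniformOn Set.finite_univ Set.univ_nonempty
  unfold sampleMeasure; infer_instance

/-- Position after the first `k` rings. -/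
def skeleton {d n : ℕ} [NeZero d] (x : domain d n) (ω : Sample d) : ℕ → domain d n
  | 0 => x
  | k + 1 => move (skeleton x ω k) (ω k).1

/-- Time of ring number `k` (counted from `0`). -/
def ringTime {d : ℕ} (ω : Sample d) (k : ℕ) : ℝ := ∑ j ∈ Finset.range (k + 1), (ω j).2

/-- Number of rings in the time interval `[0, t]` (almost surely finite). -/
def ringCount {d : ℕ} (ω : Sample d) (t : ℝ) : ℕ := {k : ℕ | ringTime ω k ≤ t}.ncard

/-- The continuous-time simple random walk on the domain started from `x`: it jumps at rate one
to each of its nearest neighbours in the domain. -/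
def walk {d n : ℕ} [NeZero d] (x : domain d n) (ω : Sample d) (t : ℝ) : domain d n :=
  skeleton x ω (ringCount ω t)

lemma neighbor_iff {d : ℕ} (x y : Fin d → ℤ) :
    Neighbor y x ↔ ∃ e : Direction d, y = x + e.vec := by
  constructor
  · intro h
    have h1 : ∃ i, y i - x i ≠ 0 := by
      by_contra! hc
      simp [Neighbor, hc] at h
    obtain ⟨i, hi⟩ := h1
    have hs : |y i - x i| + ∑ j ∈ Finset.univ.erase i, |y j - x j| = ∑ j, |y j - x j| :=
      Finset.add_sum_erase Finset.univ (fun i => |y i - x i|) (Finset.mem_univ i)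
    have h0 : 0 ≤ ∑ j ∈ Finset.univ.erase i, |y j - x j| :=
      Finset.sum_nonneg fun _ _ => abs_nonneg _
    have hi1 : 1 ≤ |y i - x i| := Int.one_le_abs hi
    unfold Neighbor at h
    have hz : ∑ j ∈ Finset.univ.erase i, |y j - x j| = 0 := by omega
    have hi2 : |y i - x i| = 1 := by omega
    rw [Finset.sum_eq_zero_iff_of_nonneg fun _ _ => abs_nonneg _] at hz
    have hother : ∀ j, j ≠ i → y j = x j := fun j hj => by
      have := hz j (by simp [hj])
      rw [abs_eq_zero] at this; omega
    rcases (abs_eq (by norm_num : (0:ℤ) ≤ 1)).1 hi2 with hh | hh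
    · refine ⟨(i, true), ?_⟩
      ext j
      by_cases hj : j = i
      · subst hj; simp [Direction.vec]; omega
      · simp [Direction.vec, hj, hother j hj]
    · refine ⟨(i, false), ?_⟩
      ext j
      by_cases hj : j = i
      · subst hj; simp [Direction.vec]; omega
      · simp [Direction.vec, hj, hother j hj]
  · rintro ⟨⟨i, b⟩, rfl⟩
    unfold Neighbor
    rw [Finset.sum_eq_single i]
    · cases b <;> simp [Direction.vec]
    · intro j _ hj; simp [Direction.vec, hj]
    · simp

lemma vec_injective {d : ℕ} : Function.Injective (Direction.vec (d := d)) := by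
  rintro ⟨i, a⟩ ⟨j, b⟩ h
  have h1 := congrFun h i
  by_cases hij : i = j
  · subst hij
    cases a <;> cases b <;> simp_all [Direction.vec]
  · cases a <;> simp [Direction.vec, hij] at h1

/-- Each of the `2 d` attempted jumps occurring at rate one gives the generator. -/
theorem sum_move_eq_generator {d n : ℕ} [NeZero d] (ψ : domain d n → ℝ) (x : domain d n) :
    ∑ e : Direction d, (ψ (move x e) - ψ x) = generator ψ x := by
  classical
  let s : Finset (Direction d) := Finset.univ.filter fun e => (x : Fin d → ℤ) + e.vec ∈ domain d n
  have hs : {y : domain d n | Neighbor (y : Fin d → ℤ) (x : Fin d → ℤ)} =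
      ((s.image (move x) : Finset (domain d n)) : Set (domain d n)) := by
    ext y
    simp only [Set.mem_ofPred_eq, neighbor_iff, Finset.coe_image, Set.mem_image, s,
      Finset.coe_filter, Finset.mem_univ, true_and]
    constructor
    · rintro ⟨e, he⟩
      have hm : (x : Fin d → ℤ) + e.vec ∈ domain d n := he ▸ y.2
      exact ⟨e, hm, by rw [move, dif_pos hm]; exact Subtype.ext he.symm⟩
    · rintro ⟨e, hm, rfl⟩
      exact ⟨e, by rw [move, dif_pos hm]⟩
  unfold generator
  rw [hs, finsum_mem_coe_finset, Finset.sum_image]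
  · rw [Finset.sum_filter]
    refine Finset.sum_congr rfl fun e _ => ?_
    split_ifs with h
    · rfl
    · simp [move, h]
  · intro e he e' he' h
    simp only [s, Finset.coe_filter, Finset.mem_univ, true_and, Set.mem_ofPred_eq] at he he'
    rw [move, move, dif_pos he, dif_pos he', Subtype.mk.injEq] at h
    exact vec_injective (add_left_cancel h)

/-- The path `X` is definitively in `A`. -/
def Definitively {S : Type*} (X : ℝ → S) (A : Set S) : Prop :=
  ∃ T : ℝ, 0 < T ∧ ∀ t, T ≤ t → X t ∈ A

/-- `p_x^+`, the probability that the walk from `x` is definitively in the right half-lattice. -/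
def pPlus {d n : ℕ} [NeZero d] (x : domain d n) : ℝ :=
  (sampleMeasure d).real {ω | Definitively (walk x ω) {y | (y : Fin d → ℤ) ∈ rightHalf d n}}

/-- `p_x^-`, the probability that the walk from `x` is definitively in the left half-lattice. -/
def pMinus {d n : ℕ} [NeZero d] (x : domain d n) : ℝ :=
  (sampleMeasure d).real {ω | Definitively (walk x ω) {y | (y : Fin d → ℤ) ∈ leftHalf d n}}

/-- `λ_x = λ^- p_x^- + λ^+ p_x^+`. -/
def lam {d n : ℕ} [NeZero d] (lm lp : ℝ) (x : domain d n) : ℝ := lm * pMinus x + lp * pPlus x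

/-- The section `Σ_ξ` of the channel, as a set of sites of the domain. -/
def channelSection (d n : ℕ) [NeZero d] (ξ : ℤ) : Set (domain d n) :=
  {x | (x : Fin d → ℤ) ∈ channel d n ∧ (x : Fin d → ℤ) 0 = ξ}

/-- The flux `I_ξ(ψ) = ∑_{x ∈ Σ_ξ} (ψ(x - e₁) - ψ(x))`; the inner sum has the single term
`y = x - e₁`, which lies in the domain whenever `|ξ| ≤ n`. -/
def flux {d n : ℕ} [NeZero d] (ψ : domain d n → ℝ) (ξ : ℤ) : ℝ :=
  ∑ᶠ x ∈ channelSection d n ξ,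
    ∑ᶠ y ∈ {y : domain d n | (y : Fin d → ℤ) = (x : Fin d → ℤ) - Pi.single 0 1}, (ψ y - ψ x)

end

end ChannelWalk

/-! The positions at the rings form a symmetric Markov chain: each of the `2 d` directions is
equally likely, and a jump that would leave the domain is suppressed. Ring times almost surely
increase to infinity, so "definitively in `A`" becomes "the skeleton is eventually in `A`"
(`definitively_walk_iff`). Conditioning on the first ring shows that the probability of this event
is harmonic in the starting point, and so is `lam`.

For `3 ≤ d`, transience comes from the finite-energy flow criterion. Pólya's urn gives a unit flow
of finite energy from the corner of `ℕ³` to infinity. Pairing it with the increments of a finitely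
supported `f` and applying Cauchy–Schwarz bounds the square of `f` at the corner by the Dirichlet
energy (`exists_sq_le_orthant_energy`). An orthant placed at the right mouth of the channel brings
this bound into the domain, and paths to the mouth spread it to every site (`energyBounded`). The
Green function truncated at `N` rings has energy at most `4 d` times its value at the pole, so it is
bounded uniformly in `N` (`exists_greenSum_le`). By Borel–Cantelli the walk leaves the finite
channel for good, and steps of size one cannot cross from one side to the other.

Non-constancy needs no estimate. If `pPlus` were a constant `c`, ending on the right would be
independent of the position at ring `k`; letting `k → ∞` gives `c = c * c`. Reflection symmetry at
the centre of the channel forces `c = 1 / 2`, a contradiction.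

For the flux, sum the harmonic equation over an interior section: lateral jumps cancel in pairs, so
the flux does not depend on the section. Telescoping from the section at `0` to the one at `n`
writes `n` times the flux as a difference of two sums of `O(n ^ (d - 1))` bounded terms. -/

namespace ChannelWalk

open Filter Topology

/-! ### The law of the rings and conditioning on the first one -/

/-- The law of a single clock ring: a uniform direction and an independent waiting time. -/
noncomputable def ringLaw (d : ℕ) : Measure (Direction d × ℝ) :=
  (uniformOn (Set.univ : Set (Direction d))).prod (expMeasure (2 * (d : ℝ)))

lemma two_mul_pos (d : ℕ) [NeZero d] : (0 : ℝ) < 2 * (d : ℝ) := by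
  have := Nat.pos_of_ne_zero (NeZero.ne d)
  positivity

instance isProbabilityMeasure_exp (d : ℕ) [NeZero d] :
    IsProbabilityMeasure (expMeasure (2 * (d : ℝ))) :=
  isProbabilityMeasure_expMeasure (two_mul_pos d)

instance isProbabilityMeasure_uniformOn_direction (d : ℕ) [NeZero d] :
    IsProbabilityMeasure (uniformOn (Set.univ : Set (Direction d))) :=
  isProbabilityMeasure_uniformOn Set.finite_univ Set.univ_nonempty

instance isProbabilityMeasure_ringLaw (d : ℕ) [NeZero d] : IsProbabilityMeasure (ringLaw d) := by
  unfold ringLaw; infer_instance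

lemma sampleMeasure_eq (d : ℕ) :
    sampleMeasure d = Measure.infinitePi fun _ : ℕ => ringLaw d := rfl

/-- Prepend one ring to a sample point. -/
def consSample {d : ℕ} (p : (Direction d × ℝ) × Sample d) : Sample d
  | 0 => p.1
  | k + 1 => p.2 k

lemma measurable_consSample {d : ℕ} : Measurable (consSample (d := d)) := by
  refine measurable_pi_lambda _ fun k => ?_
  cases k with
  | zero => exact measurable_fst
  | succ k => exact (measurable_pi_apply k).comp measurable_snd

/-- A product measure is determined by its finite cylinders. Padding a cylinder with `Set.univ`
makes its index set an initial segment, from which coordinate `0` splits off. -/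
lemma map_consSample (d : ℕ) [NeZero d] :
    ((ringLaw d).prod (sampleMeasure d)).map consSample = sampleMeasure d := by
  rw [sampleMeasure_eq]
  refine Measure.eq_infinitePi _ fun s t ht => ?_
  classical
  obtain ⟨N, hN⟩ : ∃ N, s ⊆ Finset.range (N + 1) :=
    ⟨s.sup id, fun i hi => Finset.mem_range.2 (Nat.lt_succ_of_le (Finset.le_sup (f := id) hi))⟩
  let t' : ℕ → Set (Direction d × ℝ) := fun i => if i ∈ s then t i else Set.univ
  have ht' : ∀ i, MeasurableSet (t' i) := fun i => by
    by_cases hi : i ∈ s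
    · simpa [t', hi] using ht i
    · simp [t', hi]
  have hpi : Set.pi (s : Set ℕ) t = Set.pi (Finset.range (N + 1) : Set ℕ) t' := by
    ext ω
    simp only [Set.mem_pi, Finset.mem_coe, t']
    constructor
    · intro h i _
      by_cases hi : i ∈ s
      · simpa [hi] using h i hi
      · simp [hi]
    · intro h i hi
      simpa [hi] using h i (hN hi)
  have hprod : ∏ i ∈ s, ringLaw d (t i) = ∏ i ∈ Finset.range (N + 1), ringLaw d (t' i) := by
    rw [← Finset.prod_subset hN (f := fun i => ringLaw d (t' i))]
    · exact Finset.prod_congr rfl fun i hi => by simp [t', hi]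
    · intro i _ hi
      simp [t', hi]
  rw [hpi, hprod, Measure.map_apply measurable_consSample
    (MeasurableSet.pi (Finset.countable_toSet _) fun i _ => ht' i)]
  have hpre : consSample ⁻¹' Set.pi (Finset.range (N + 1) : Set ℕ) t' =
      t' 0 ×ˢ Set.pi (Finset.range N : Set ℕ) fun i => t' (i + 1) := by
    ext ⟨a, ω⟩
    simp only [Set.mem_preimage, Set.mem_pi, Finset.mem_coe, Finset.mem_range, Set.mem_prod]
    constructor
    · intro h
      exact ⟨h 0 (Nat.succ_pos N), fun i hi => h (i + 1) (Nat.succ_lt_succ hi)⟩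
    · rintro ⟨h0, h⟩ i hi
      cases i with
      | zero => exact h0
      | succ i => exact h i (Nat.lt_of_succ_lt_succ hi)
  rw [hpre, Measure.prod_prod, Measure.infinitePi_pi _ (fun i _ => ht' (i + 1)),
    Finset.prod_range_succ', mul_comm]

lemma ringLaw_direction (d : ℕ) [NeZero d] (e : Direction d) :
    (ringLaw d).real ({e} ×ˢ Set.univ) = (2 * (d : ℝ))⁻¹ := by
  classical
  rw [ringLaw, measureReal_prod_prod, probReal_univ, Measure.real, uniformOn_univ,
    Measure.count_singleton]
  simp [mul_comm]

/-- Conditioning on the direction of the first ring. -/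
lemma sampleMeasure_firstStep {d : ℕ} [NeZero d] {T : Direction d → Set (Sample d)}
    (hT : ∀ e, MeasurableSet (T e)) :
    2 * (d : ℝ) * (sampleMeasure d).real {ω | (fun k => ω (k + 1)) ∈ T (ω 0).1} =
      ∑ e, (sampleMeasure d).real (T e) := by
  have hshift : Measurable fun (ω : Sample d) (k : ℕ) => ω (k + 1) :=
    measurable_pi_lambda _ fun k => measurable_pi_apply (k + 1)
  have hU : {ω : Sample d | (fun k => ω (k + 1)) ∈ T (ω 0).1} =
      ⋃ e ∈ (Finset.univ : Finset (Direction d)),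
        {ω | (ω 0).1 = e ∧ (fun k => ω (k + 1)) ∈ T e} := by
    ext ω
    simp
  have hmeas : ∀ e, MeasurableSet {ω : Sample d | (ω 0).1 = e ∧ (fun k => ω (k + 1)) ∈ T e} :=
    fun e => ((measurable_fst.comp (measurable_pi_apply 0)) (measurableSet_singleton e)).inter
      (hshift (hT e))
  rw [hU, measureReal_biUnion_finset _ fun e _ => hmeas e, Finset.mul_sum]
  · refine Finset.sum_congr rfl fun e _ => ?_
    have hpre : consSample ⁻¹' {ω : Sample d | (ω 0).1 = e ∧ (fun k => ω (k + 1)) ∈ T e} =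
        ({e} ×ˢ Set.univ) ×ˢ T e := by
      ext ⟨⟨e', s⟩, ω⟩
      simp [consSample]
    conv_lhs => rw [← map_consSample d]
    rw [map_measureReal_apply measurable_consSample (hmeas e), hpre, measureReal_prod_prod,
      ringLaw_direction, mul_inv_cancel_left₀ (two_mul_pos d).ne']
  · intro e _ e' _ he
    refine Set.disjoint_left.2 fun ω h h' => he ?_
    exact h.1.symm.trans h'.1

/-! ### The discrete skeleton and its Markov property -/

section Skeleton

variable {d n : ℕ} [NeZero d]

lemma measurable_skeleton (x : domain d n) (k : ℕ) :
    Measurable fun ω : Sample d => skeleton x ω k := by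
  induction k with
  | zero => exact measurable_const
  | succ k ih =>
    have h : Measurable fun p : domain d n × Direction d => move p.1 p.2 := measurable_of_countable _
    exact h.comp (ih.prodMk (measurable_fst.comp (measurable_pi_apply k)))

lemma measurableSet_skeleton_mem (x : domain d n) (k : ℕ) (A : Set (domain d n)) :
    MeasurableSet {ω : Sample d | skeleton x ω k ∈ A} :=
  measurable_skeleton x k A.to_countable.measurableSet

/-- The recursion defining `skeleton` peels off the last ring; first-step analysis needs the first
ring peeled off instead. -/
lemma skeleton_succ (x : domain d n) (ω : Sample d) (k : ℕ) :
    skeleton x ω (k + 1) = skeleton (move x (ω 0).1) (fun j => ω (j + 1)) k := by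
  induction k with
  | zero => rfl
  | succ k ih => rw [skeleton, ih]; rfl

/-- The event that the discrete skeleton is eventually in `A`. -/
def eventuallyIn (x : domain d n) (A : Set (domain d n)) : Set (Sample d) :=
  {ω | ∀ᶠ k in atTop, skeleton x ω k ∈ A}

lemma measurableSet_eventuallyIn (x : domain d n) (A : Set (domain d n)) :
    MeasurableSet (eventuallyIn x A) := by
  have h : eventuallyIn x A = ⋃ K : ℕ, ⋂ k : ℕ, ⋂ _ : K ≤ k, {ω | skeleton x ω k ∈ A} := by
    ext ω
    simp [eventuallyIn]
  rw [h]
  exact .iUnion fun K => .iInter fun k => .iInter fun _ => measurableSet_skeleton_mem x k A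

lemma eventuallyIn_eq (x : domain d n) (A : Set (domain d n)) :
    eventuallyIn x A = {ω | (fun k => ω (k + 1)) ∈ eventuallyIn (move x (ω 0).1) A} := by
  ext ω
  simp only [eventuallyIn, Set.mem_ofPred_eq]
  simp only [← skeleton_succ]
  conv_lhs => rw [← map_add_atTop_eq_nat 1, eventually_map]

lemma sum_eventuallyIn (x : domain d n) (A : Set (domain d n)) :
    ∑ e, (sampleMeasure d).real (eventuallyIn (move x e) A) =
      2 * (d : ℝ) * (sampleMeasure d).real (eventuallyIn x A) := by
  rw [eventuallyIn_eq x A,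
    ← sampleMeasure_firstStep fun e => measurableSet_eventuallyIn (move x e) A]

/-- The probability that the walk from `x` is in `A` after `k` rings. -/
noncomputable def skeletonProb (A : Set (domain d n)) (k : ℕ) (x : domain d n) : ℝ :=
  (sampleMeasure d).real {ω | skeleton x ω k ∈ A}

lemma skeletonProb_nonneg (A : Set (domain d n)) (k : ℕ) (x : domain d n) :
    0 ≤ skeletonProb A k x := measureReal_nonneg

open Classical in
lemma skeletonProb_zero (A : Set (domain d n)) (x : domain d n) :
    skeletonProb A 0 x = if x ∈ A then 1 else 0 := by
  by_cases h : x ∈ A <;> simp [skeletonProb, skeleton, h]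

/-- The backward equation of the chain, which drives all later inductions on `k`. -/
lemma sum_skeletonProb (A : Set (domain d n)) (k : ℕ) (x : domain d n) :
    ∑ e, skeletonProb A k (move x e) = 2 * (d : ℝ) * skeletonProb A (k + 1) x := by
  simp only [skeletonProb, skeleton_succ]
  exact (sampleMeasure_firstStep fun e => measurableSet_skeleton_mem (move x e) k A).symm

end Skeleton

/-! ### From continuous time to the skeleton -/

section Clock

variable {d : ℕ}

lemma ringTime_strictMono {ω : Sample d} (h : ∀ k, 0 < (ω k).2) : StrictMono (ringTime ω) :=
  strictMono_nat_of_lt_succ fun k => by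
    unfold ringTime
    rw [Finset.sum_range_succ _ (k + 1)]
    linarith [h (k + 1)]

lemma ae_waiting_pos [NeZero d] : ∀ᵐ ω ∂sampleMeasure d, ∀ k, 0 < (ω k).2 := by
  rw [ae_all_iff]
  intro k
  have h1 : ∀ᵐ s ∂expMeasure (2 * (d : ℝ)), 0 < s := by
    rw [ae_iff]
    have h := cdf_expMeasure_eq (two_mul_pos d) 0
    rw [cdf_eq_real] at h
    have h2 : {a : ℝ | ¬ 0 < a} = Set.Iic 0 := by ext; simp
    rw [h2, ← measureReal_eq_zero_iff, h]
    simp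
  have h2 : ∀ᵐ p ∂ringLaw d, 0 < p.2 :=
    (Measure.quasiMeasurePreserving_snd
      (μ := uniformOn (Set.univ : Set (Direction d)))).ae h1
  exact (measurePreserving_eval_infinitePi (fun _ : ℕ => ringLaw d) k).quasiMeasurePreserving.ae h2

/-- Second Borel–Cantelli lemma: the events are independent with the same positive probability. This
rules out explosion. -/
lemma ae_frequently_waiting [NeZero d] : ∀ᵐ ω ∂sampleMeasure d, ∃ᶠ k in atTop, 1 < (ω k).2 := by
  let s : ℕ → Set (Sample d) := fun k => {ω | (ω k).2 ∈ Set.Ioi (1 : ℝ)}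
  have hs : ∀ k, MeasurableSet (s k) := fun k =>
    (measurable_snd.comp (measurable_pi_apply k)) measurableSet_Ioi
  have hind : iIndepFun (fun (k : ℕ) (ω : Sample d) => (ω k).2) (sampleMeasure d) :=
    iIndepFun_infinitePi (P := fun _ : ℕ => ringLaw d) fun _ => measurable_snd
  have hindS : iIndepSet s (sampleMeasure d) :=
    (iIndepSet_iff_meas_biInter hs).2 fun S =>
      hind.measure_inter_preimage_eq_mul S (fun _ _ => measurableSet_Ioi)
  have hval : ∀ k, sampleMeasure d (s k) = expMeasure (2 * (d : ℝ)) (Set.Ioi 1) := fun k => by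
    have h := (measurePreserving_eval_infinitePi (fun _ : ℕ => ringLaw d) k).measure_preimage
      (s := Set.univ ×ˢ Set.Ioi (1 : ℝ)) (MeasurableSet.univ.prod measurableSet_Ioi).nullMeasurableSet
    rw [ringLaw, Measure.prod_prod, measure_univ, one_mul] at h
    rw [← h]
    congr 1
    ext ω
    simp [s]
  have hpos : expMeasure (2 * (d : ℝ)) (Set.Ioi 1) ≠ 0 := by
    intro h
    have h1 := cdf_expMeasure_eq (two_mul_pos d) 1
    rw [cdf_eq_real] at h1
    have h2 := measureReal_compl (μ := expMeasure (2 * (d : ℝ))) (measurableSet_Iic (a := (1 : ℝ)))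
    rw [Set.compl_Iic, h1, Measure.real, h] at h2
    have h3 := Real.exp_pos (-(2 * (d : ℝ) * 1))
    simp only [ENNReal.toReal_zero, probReal_univ, zero_le_one, if_true] at h2
    linarith
  have hlim := measure_limsup_eq_one hs hindS
    (by simp only [hval]; exact ENNReal.tsum_const_eq_top_of_ne_zero hpos)
  have hm : MeasurableSet (limsup s atTop) := MeasurableSet.measurableSet_limsup hs
  have := (prob_compl_eq_zero_iff hm).2 hlim
  filter_upwards [compl_mem_ae_iff.2 this] with ω hω
  rw [compl_compl, mem_limsup_iff_frequently_mem] at hω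
  exact hω

lemma tendsto_ringTime {ω : Sample d} (h : ∀ k, 0 < (ω k).2)
    (h' : ∃ᶠ k in atTop, 1 < (ω k).2) : Tendsto (ringTime ω) atTop atTop := by
  refine (ringTime_strictMono h).monotone.tendsto_atTop_atTop fun b => ?_
  have key : ∀ m : ℕ, ∃ k, (m : ℝ) ≤ ringTime ω k := by
    intro m
    induction m with
    | zero => exact ⟨0, by simpa [ringTime] using (h 0).le⟩
    | succ m ih =>
      obtain ⟨k, hk⟩ := ih
      obtain ⟨j, hj, hj'⟩ := frequently_atTop.1 h' (k + 1)
      refine ⟨j, ?_⟩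
      obtain ⟨i, rfl⟩ : ∃ i, j = i + 1 := ⟨j - 1, by omega⟩
      have h1 : ringTime ω (i + 1) = ringTime ω i + (ω (i + 1)).2 := by
        unfold ringTime; rw [Finset.sum_range_succ _ (i + 1)]
      have h2 : ringTime ω k ≤ ringTime ω i := (ringTime_strictMono h).monotone (by omega)
      push_cast
      linarith
  obtain ⟨m, hm⟩ := exists_nat_ge b
  obtain ⟨k, hk⟩ := key m
  exact ⟨k, hm.trans hk⟩

/-- `ringCount` is an `ncard`, with default value `0` on infinite sets. Since ring times increase to
infinity, the set counted is a finite initial segment. -/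
lemma lt_ringCount_iff {ω : Sample d} (h : ∀ k, 0 < (ω k).2)
    (h' : ∃ᶠ k in atTop, 1 < (ω k).2) (t : ℝ) (k : ℕ) :
    k < ringCount ω t ↔ ringTime ω k ≤ t := by
  classical
  have hmono := ringTime_strictMono h
  have hex : ∃ k, t < ringTime ω k :=
    ((tendsto_ringTime h h').eventually_gt_atTop t).exists
  have hset : {k : ℕ | ringTime ω k ≤ t} = (Finset.range (Nat.find hex) : Set ℕ) := by
    ext j
    simp only [Set.mem_ofPred_eq, Finset.coe_range, Set.mem_Iio, Nat.lt_find_iff, not_lt]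
    exact ⟨fun hj i hi => (hmono.monotone hi).trans hj, fun hj => hj j le_rfl⟩
  have hc : ringCount ω t = Nat.find hex := by
    rw [ringCount, hset, Set.ncard_coe_finset, Finset.card_range]
  rw [hc, Nat.lt_find_iff]
  simp only [not_lt]
  exact ⟨fun hj => hj k le_rfl, fun hj i hi => (hmono.monotone hi).trans hj⟩

lemma definitively_walk_iff [NeZero d] {n : ℕ} {ω : Sample d} (h : ∀ k, 0 < (ω k).2)
    (h' : ∃ᶠ k in atTop, 1 < (ω k).2) (x : domain d n) (A : Set (domain d n)) :
    Definitively (walk x ω) A ↔ ω ∈ eventuallyIn x A := by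
  have hmono := ringTime_strictMono h
  simp only [eventuallyIn, Set.mem_ofPred_eq, eventually_atTop]
  constructor
  · rintro ⟨T, _, hT⟩
    obtain ⟨K, hK⟩ := ((tendsto_ringTime h h').eventually_ge_atTop T).exists
    refine ⟨K + 1, fun k hk => ?_⟩
    obtain ⟨j, rfl⟩ : ∃ j, k = j + 1 := ⟨k - 1, by omega⟩
    have hj := hT (ringTime ω j) (hK.trans (hmono.monotone (by omega)))
    -- A ring occurring exactly at time `t` is counted, and rings are numbered from `0`; hence `j +
    -- 1`.
    have hcount : ringCount ω (ringTime ω j) = j + 1 := by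
      have h1 := (lt_ringCount_iff h h' (ringTime ω j) j).2 le_rfl
      have h2 : ¬ j + 1 < ringCount ω (ringTime ω j) := fun hlt =>
        absurd ((lt_ringCount_iff h h' _ _).1 hlt) (not_le.2 (hmono (Nat.lt_succ_self j)))
      omega
    rwa [walk, hcount] at hj
  · rintro ⟨K, hK⟩
    refine ⟨max 1 (ringTime ω K), by positivity, fun t ht => ?_⟩
    exact hK _ ((lt_ringCount_iff h h' t K).2 ((le_max_right _ _).trans ht)).le

lemma sampleMeasure_definitively [NeZero d] {n : ℕ} (x : domain d n) (A : Set (domain d n)) :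
    (sampleMeasure d).real {ω | Definitively (walk x ω) A} =
      (sampleMeasure d).real (eventuallyIn x A) := by
  refine measureReal_congr ?_
  filter_upwards [ae_waiting_pos, ae_frequently_waiting] with ω h h'
  exact propext (definitively_walk_iff h h' x A)

end Clock

/-! ### Harmonicity and boundedness -/

section Harmonic

variable {d n : ℕ} [NeZero d]

/-- The sites of the domain in the right half-lattice. -/
def rightSites (d n : ℕ) [NeZero d] : Set (domain d n) := {y | (y : Fin d → ℤ) ∈ rightHalf d n}

/-- The sites of the domain in the left half-lattice. -/
def leftSites (d n : ℕ) [NeZero d] : Set (domain d n) := {y | (y : Fin d → ℤ) ∈ leftHalf d n}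

lemma pPlus_eq (x : domain d n) :
    pPlus x = (sampleMeasure d).real (eventuallyIn x (rightSites d n)) :=
  sampleMeasure_definitively x _

lemma pMinus_eq (x : domain d n) :
    pMinus x = (sampleMeasure d).real (eventuallyIn x (leftSites d n)) :=
  sampleMeasure_definitively x _

/-- A suppressed jump contributes `ψ x` to the sum, so the mean value property holds over all `2 d`
directions, even at the boundary. -/
lemma isHarmonic_iff (ψ : domain d n → ℝ) :
    IsHarmonic ψ ↔ ∀ x, ∑ e, ψ (move x e) = 2 * (d : ℝ) * ψ x := by
  refine forall_congr' fun x => ?_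
  rw [← sum_move_eq_generator, Finset.sum_sub_distrib, sub_eq_zero]
  simp [Fintype.card_prod, mul_comm]

lemma isHarmonic_lam (lm lp : ℝ) : IsHarmonic fun x : domain d n => lam lm lp x := by
  rw [isHarmonic_iff]
  intro x
  simp only [lam, pPlus_eq, pMinus_eq, Finset.sum_add_distrib, ← Finset.mul_sum, sum_eventuallyIn]
  ring

lemma abs_lam_le (lm lp : ℝ) (x : domain d n) : |lam lm lp x| ≤ |lm| + |lp| := by
  have h : ∀ (a p : ℝ), 0 ≤ p → p ≤ 1 → |a * p| ≤ |a| := fun a p h0 h1 => by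
    rw [abs_mul, abs_of_nonneg h0]
    exact mul_le_of_le_one_right (abs_nonneg a) h1
  exact (abs_add_le _ _).trans (add_le_add (h _ _ measureReal_nonneg measureReal_le_one)
    (h _ _ measureReal_nonneg measureReal_le_one))

end Harmonic

/-! ### Reversibility of the jumps -/

section Moves

variable {d n : ℕ} [NeZero d]

/-- The opposite direction. -/
def Direction.opp {d : ℕ} (e : Direction d) : Direction d := (e.1, !e.2)

lemma Direction.vec_opp {d : ℕ} (e : Direction d) : e.opp.vec = -e.vec := by
  obtain ⟨i, b⟩ := e
  cases b <;> simp [Direction.opp, Direction.vec, ← Pi.single_neg]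

lemma Direction.opp_opp {d : ℕ} (e : Direction d) : e.opp.opp = e := by
  simp [Direction.opp]

lemma move_of_mem {x : domain d n} {e : Direction d} (h : (x : Fin d → ℤ) + e.vec ∈ domain d n) :
    move x e = ⟨x + e.vec, h⟩ := dif_pos h

lemma move_of_notMem {x : domain d n} {e : Direction d}
    (h : (x : Fin d → ℤ) + e.vec ∉ domain d n) : move x e = x := dif_neg h

open Classical in
/-- Reverse an attempted jump: a suppressed jump is its own reverse. -/
noncomputable def reverseJump (p : domain d n × Direction d) : domain d n × Direction d :=
  (move p.1 p.2, if (p.1 : Fin d → ℤ) + p.2.vec ∈ domain d n then p.2.opp else p.2)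

/-- This is reversibility with respect to counting measure. It serves both the cancellation of
lateral jumps and the summation by parts for the energy. -/
lemma reverseJump_involutive : Function.Involutive (reverseJump (d := d) (n := n)) := by
  rintro ⟨x, e⟩
  by_cases h : (x : Fin d → ℤ) + e.vec ∈ domain d n
  · have h1 : (x : Fin d → ℤ) + e.vec + e.opp.vec = x := by rw [Direction.vec_opp]; abel
    have h2 : (x : Fin d → ℤ) + e.vec + e.opp.vec ∈ domain d n := by rw [h1]; exact x.2
    have h3 : reverseJump (x, e) = (⟨x + e.vec, h⟩, e.opp) := by
      simp [reverseJump, h, move_of_mem h]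
    rw [h3]
    refine Prod.ext ?_ ?_
    · change move (⟨x + e.vec, h⟩ : domain d n) e.opp = x
      rw [move_of_mem h2]
      exact Subtype.ext h1
    · simp only [reverseJump, h2, if_true, Direction.opp_opp]
  · have h3 : reverseJump (x, e) = (x, e) := by simp [reverseJump, h, move_of_notMem h]
    rw [h3, h3]

lemma reverseJump_fst (p : domain d n × Direction d) : (reverseJump p).1 = move p.1 p.2 := rfl

lemma reverseJump_snd_fst (p : domain d n × Direction d) : (reverseJump p).2.1 = p.2.1 := by
  simp only [reverseJump]
  split_ifs <;> rfl

lemma move_apply_of_ne (x : domain d n) (e : Direction d) {i : Fin d} (h : i ≠ e.1) :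
    (move x e : Fin d → ℤ) i = (x : Fin d → ℤ) i := by
  by_cases hx : (x : Fin d → ℤ) + e.vec ∈ domain d n
  · simp [move_of_mem hx, Direction.vec, h]
  · rw [move_of_notMem hx]

end Moves

/-! ### Conservation of the flux and its bound -/

section Flux

variable {d n : ℕ} [NeZero d]

lemma mem_channel_of_lt {x : Fin d → ℤ} (hx : x ∈ domain d n) (h : |x 0| < n) :
    x ∈ channel d n := by
  rw [abs_lt] at h
  rcases hx with (hx | hx) | hx
  · have : (n : ℤ) ≤ x 0 := hx
    omega
  · exact hx
  · have : x 0 ≤ -(n : ℤ) := hx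
    omega

lemma mem_domain_of_update {x : Fin d → ℤ} (hx : x ∈ channel d n) (k : ℤ) :
    Function.update x 0 k ∈ domain d n := by
  by_cases h1 : (n : ℤ) ≤ k
  · exact Or.inl (Or.inl (by simpa [rightHalf] using h1))
  by_cases h2 : k ≤ -(n : ℤ)
  · exact Or.inr (by simpa [leftHalf] using h2)
  refine Or.inl (Or.inr fun i => ?_)
  by_cases hi : i = 0
  · subst hi
    rw [Function.update_self, abs_le]
    omega
  · rw [Function.update_of_ne hi]
    exact hx i

lemma add_vec_zero (x : Fin d → ℤ) (b : Bool) :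
    x + Direction.vec (0, b) = Function.update x 0 (x 0 + if b then 1 else -1) := by
  ext i
  by_cases hi : i = 0
  · subst hi; simp [Direction.vec]
  · simp [Direction.vec, hi]

lemma move_zero_coe {x : domain d n} (hx : (x : Fin d → ℤ) ∈ channel d n) (b : Bool) :
    (move x (0, b) : Fin d → ℤ) = (x : Fin d → ℤ) + Direction.vec (0, b) := by
  have h : (x : Fin d → ℤ) + Direction.vec (0, b) ∈ domain d n := by
    rw [add_vec_zero]; exact mem_domain_of_update hx _
  rw [move_of_mem h]

lemma finite_channelSection (ξ : ℤ) : (channelSection d n ξ).Finite := by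
  have h : (Set.pi Set.univ fun _ : Fin d => Set.Icc (-(n : ℤ)) n).Finite :=
    Set.Finite.pi fun _ => Set.finite_Icc _ _
  refine Set.Finite.subset (h.preimage Subtype.val_injective.injOn) fun x hx => ?_
  exact fun i _ => abs_le.1 (hx.1 i)

/-- The section `Σ_ξ` as a finset. -/
noncomputable def sectionFinset (d n : ℕ) [NeZero d] (ξ : ℤ) : Finset (domain d n) :=
  (finite_channelSection (d := d) (n := n) ξ).toFinset

lemma mem_sectionFinset {ξ : ℤ} {x : domain d n} :
    x ∈ sectionFinset d n ξ ↔ (x : Fin d → ℤ) ∈ channel d n ∧ (x : Fin d → ℤ) 0 = ξ :=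
  Set.Finite.mem_toFinset _

lemma mem_sectionFinset_of_lt {ξ : ℤ} (hξ : |ξ| < n) {x : domain d n} :
    x ∈ sectionFinset d n ξ ↔ (x : Fin d → ℤ) 0 = ξ := by
  rw [mem_sectionFinset]
  exact ⟨fun h => h.2, fun h => ⟨mem_channel_of_lt x.2 (by rwa [h]), h⟩⟩

lemma card_sectionFinset_le (ξ : ℤ) : (sectionFinset d n ξ).card ≤ (2 * n + 1) ^ (d - 1) := by
  classical
  let S : Finset (Fin d → ℤ) :=
    Fintype.piFinset fun i => if i = 0 then {ξ} else Finset.Icc (-(n : ℤ)) n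
  have h1 : (sectionFinset d n ξ).card ≤ S.card := by
    refine Finset.card_le_card_of_injOn Subtype.val (fun x hx => ?_) Subtype.val_injective.injOn
    rw [Finset.mem_coe, mem_sectionFinset] at hx
    refine Finset.mem_coe.2 (Fintype.mem_piFinset.2 fun i => ?_)
    by_cases hi : i = 0
    · subst hi; simp [hx.2]
    · simpa [hi] using abs_le.1 (hx.1 i)
  refine h1.trans (le_of_eq ?_)
  have h2 : ∀ i : Fin d, ((if i = 0 then {ξ} else Finset.Icc (-(n : ℤ)) n) : Finset ℤ).card =
      if i = 0 then 1 else 2 * n + 1 := fun i => by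
    split_ifs
    · simp
    · rw [Int.card_Icc]; omega
  rw [Fintype.card_piFinset, Finset.prod_congr rfl fun i _ => h2 i, Finset.prod_ite]
  simp [Finset.filter_ne', Finset.card_erase_of_mem]

/-- A sum over one section of the channel is the sum of the shifted function over the next. -/
lemma sum_sectionFinset_move (ψ : domain d n → ℝ) {ξ : ℤ} (h1 : -(n : ℤ) ≤ ξ) (h2 : ξ < n) :
    ∑ x ∈ sectionFinset d n ξ, ψ (move x (0, true)) = ∑ x ∈ sectionFinset d n (ξ + 1), ψ x ∧
    ∑ x ∈ sectionFinset d n (ξ + 1), ψ (move x (0, false)) = ∑ x ∈ sectionFinset d n ξ, ψ x := by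
  have hmem : ∀ (η : ℤ) (b : Bool) (x : domain d n), x ∈ sectionFinset d n η →
      |η + if b then 1 else -1| ≤ (n : ℤ) →
      move x (0, b) ∈ sectionFinset d n (η + if b then 1 else -1) := by
    intro η b x hx hη
    rw [mem_sectionFinset] at hx ⊢
    rw [move_zero_coe hx.1, add_vec_zero, hx.2, Function.update_self]
    refine ⟨fun i => ?_, rfl⟩
    by_cases hi : i = 0
    · subst hi; rwa [Function.update_self]
    · rw [Function.update_of_ne hi]; exact hx.1 i
  have hf : ∀ x ∈ sectionFinset d n ξ, move x (0, true) ∈ sectionFinset d n (ξ + 1) :=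
    fun x hx => hmem ξ true x hx (by rw [if_pos rfl, abs_le]; omega)
  have hg : ∀ x ∈ sectionFinset d n (ξ + 1), move x (0, false) ∈ sectionFinset d n ξ :=
    fun x hx => by
      have := hmem (ξ + 1) false x hx (by simp only [Bool.false_eq_true, if_false, abs_le]; omega)
      simpa using this
  have hinv : ∀ (η : ℤ) (b : Bool) (x : domain d n), x ∈ sectionFinset d n η →
      move x (0, b) ∈ sectionFinset d n (η + if b then 1 else -1) →
      move (move x (0, b)) (0, !b) = x := by
    intro η b x hx hx'
    rw [mem_sectionFinset] at hx hx'
    refine Subtype.ext ?_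
    rw [move_zero_coe hx'.1, move_zero_coe hx.1]
    have h := Direction.vec_opp ((0, b) : Direction d)
    simp only [Direction.opp] at h
    rw [h]; abel
  have hfg : ∀ x ∈ sectionFinset d n ξ, move (move x (0, true)) (0, false) = x :=
    fun x hx => hinv ξ true x hx (hf x hx)
  have hgf : ∀ x ∈ sectionFinset d n (ξ + 1), move (move x (0, false)) (0, true) = x :=
    fun x hx => hinv (ξ + 1) false x hx (by simpa using hg x hx)
  exact ⟨Finset.sum_bij' (fun x _ => move x (0, true)) (fun x _ => move x (0, false)) hf hg hfg hgf
      fun _ _ => rfl,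
    Finset.sum_bij' (fun x _ => move x (0, false)) (fun x _ => move x (0, true)) hg hf hgf hfg
      fun _ _ => rfl⟩

/-- The flux is the difference of the sums over two neighbouring sections. -/
lemma flux_eq (ψ : domain d n → ℝ) {ξ : ℤ} (h1 : -(n : ℤ) < ξ) (h2 : ξ ≤ n) :
    flux ψ ξ = ∑ x ∈ sectionFinset d n (ξ - 1), ψ x - ∑ x ∈ sectionFinset d n ξ, ψ x := by
  have hmove := (sum_sectionFinset_move ψ (ξ := ξ - 1) (by omega) (by omega)).2
  rw [sub_add_cancel] at hmove
  rw [← hmove, ← Finset.sum_sub_distrib]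
  unfold flux
  rw [← Set.Finite.coe_toFinset (finite_channelSection ξ), finsum_mem_coe_finset]
  refine Finset.sum_congr rfl fun x hx => ?_
  have hx' := (mem_sectionFinset.1 hx).1
  have hset : {y : domain d n | (y : Fin d → ℤ) = (x : Fin d → ℤ) - Pi.single 0 1} =
      {move x (0, false)} := by
    ext y
    rw [Set.mem_singleton_iff, Set.mem_ofPred_eq, Subtype.ext_iff, move_zero_coe hx']
    simp [Direction.vec, sub_eq_add_neg, ← Pi.single_neg]
  rw [hset, finsum_mem_singleton]

/-- Lateral jumps preserve sums over a section in the interior of the channel. -/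
lemma sum_lateral (ψ : domain d n → ℝ) {ξ : ℤ} (hξ : |ξ| < n) :
    ∑ x ∈ sectionFinset d n ξ, ∑ e with e.1 ≠ 0, (ψ (move x e) - ψ x) = 0 := by
  rw [← Finset.sum_product', Finset.sum_sub_distrib, sub_eq_zero]
  -- Jumps with `e.1 ≠ 0` fix the first coordinate, and an interior section contains every site with
  -- that coordinate. Thus `reverseJump` permutes the lateral jumps from the section.
  have hmem : ∀ p ∈ sectionFinset d n ξ ×ˢ Finset.univ.filter fun e : Direction d => e.1 ≠ 0,
      reverseJump p ∈ sectionFinset d n ξ ×ˢ Finset.univ.filter fun e : Direction d => e.1 ≠ 0 := by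
    rintro p hp
    simp only [Finset.mem_product, Finset.mem_filter, Finset.mem_univ, true_and,
      mem_sectionFinset_of_lt hξ, reverseJump_snd_fst, reverseJump_fst] at hp ⊢
    exact ⟨by rw [move_apply_of_ne _ _ hp.2.symm]; exact hp.1, hp.2⟩
  exact Finset.sum_bij' (fun p _ => reverseJump p) (fun p _ => reverseJump p) hmem hmem
    (fun p _ => reverseJump_involutive p) (fun p _ => reverseJump_involutive p)
    fun p _ => by rw [reverseJump_fst]

lemma flux_succ {ψ : domain d n → ℝ} (hψ : IsHarmonic ψ) {ξ : ℤ} (hξ : |ξ| < n) :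
    flux ψ (ξ + 1) = flux ψ ξ := by
  have h := abs_lt.1 hξ
  have hsum : ∑ x ∈ sectionFinset d n ξ, ∑ e : Direction d, (ψ (move x e) - ψ x) = 0 :=
    Finset.sum_eq_zero fun x _ => by rw [sum_move_eq_generator]; exact hψ x
  have hsplit : ∀ x : domain d n, ∑ e : Direction d, (ψ (move x e) - ψ x) =
      ∑ e with e.1 ≠ 0, (ψ (move x e) - ψ x) +
        ((ψ (move x (0, true)) - ψ x) + (ψ (move x (0, false)) - ψ x)) := by
    intro x
    rw [← Finset.sum_filter_add_sum_filter_not Finset.univ fun e : Direction d => e.1 ≠ 0]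
    congr 1
    have hf : (Finset.univ.filter fun e : Direction d => ¬ e.1 ≠ 0) = {(0, true), (0, false)} := by
      ext ⟨i, b⟩
      cases b <;> simp
    rw [hf, Finset.sum_pair (by simp)]
  simp only [hsplit] at hsum
  rw [Finset.sum_add_distrib, sum_lateral ψ hξ, zero_add, Finset.sum_add_distrib,
    Finset.sum_sub_distrib, Finset.sum_sub_distrib,
    (sum_sectionFinset_move ψ (by omega) h.2).1] at hsum
  have hleft := (sum_sectionFinset_move ψ (ξ := ξ - 1) (by omega) (by omega)).2
  rw [sub_add_cancel] at hleft
  rw [flux_eq ψ (by omega) (by omega), flux_eq ψ (by omega) (by omega), add_sub_cancel_right]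
  linarith

lemma flux_eq_flux_zero {ψ : domain d n → ℝ} (hψ : IsHarmonic ψ) {ξ : ℤ} (hξ : |ξ| < n) :
    flux ψ ξ = flux ψ 0 := by
  rw [abs_lt] at hξ
  have hpos : ∀ k : ℕ, (k : ℤ) < n → flux ψ k = flux ψ 0 := by
    intro k
    induction k with
    | zero => simp
    | succ k ih =>
      intro hk
      push_cast at hk ⊢
      rw [flux_succ hψ (by rw [abs_lt]; omega)]
      exact ih (by omega)
  have hneg : ∀ k : ℕ, (k : ℤ) < n → flux ψ (-k) = flux ψ 0 := by
    intro k
    induction k with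
    | zero => simp
    | succ k ih =>
      intro hk
      push_cast at hk
      rw [← ih (by omega), ← flux_succ hψ (by rw [abs_lt]; push_cast; omega)]
      congr 1
      push_cast
      ring
  obtain ⟨k, rfl | rfl⟩ := Int.eq_nat_or_neg ξ
  · exact hpos k (by omega)
  · exact hneg k (by omega)

lemma sum_sectionFinset_sub {ψ : domain d n → ℝ} (hψ : IsHarmonic ψ) (k : ℕ) (hk : k < n) :
    ∑ x ∈ sectionFinset d n 0, ψ x - ∑ x ∈ sectionFinset d n k, ψ x = k * flux ψ 0 := by
  induction k with
  | zero => simp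
  | succ k ih =>
    have h1 := flux_eq ψ (ξ := (k : ℤ) + 1) (by omega) (by omega)
    rw [flux_eq_flux_zero hψ (by rw [abs_lt]; omega), add_sub_cancel_right] at h1
    have h2 := ih (by omega)
    push_cast
    linarith

/-- The last step uses the flux at `ξ = n`, which conservation at `n - 1` still reaches. This gives
the full factor `n`, and a non-empty statement when `n = 1`. -/
lemma sum_sectionFinset_sub_top {ψ : domain d n → ℝ} (hψ : IsHarmonic ψ) (hn : 1 ≤ n) :
    ∑ x ∈ sectionFinset d n 0, ψ x - ∑ x ∈ sectionFinset d n n, ψ x = n * flux ψ 0 := by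
  obtain ⟨k, rfl⟩ : ∃ k, n = k + 1 := ⟨n - 1, by omega⟩
  have h1 := flux_eq ψ (ξ := (k : ℤ) + 1) (by push_cast; omega) (by push_cast; omega)
  rw [flux_succ hψ (by rw [abs_lt]; push_cast; omega), add_sub_cancel_right,
    flux_eq_flux_zero hψ (by rw [abs_lt]; push_cast; omega)] at h1
  have h2 := sum_sectionFinset_sub hψ k (by omega)
  push_cast
  linarith

lemma abs_flux_div_le {ψ : domain d n → ℝ} (hψ : IsHarmonic ψ) (hn : 1 ≤ n) {M : ℝ}
    (hM : ∀ x, |ψ x| ≤ M) {ξ : ℤ} (hξ : |ξ| < n) :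
    |flux ψ ξ| / (n : ℝ) ^ (d - 1) ≤ 2 * M * 3 ^ (d - 1) / n := by
  have hn' : (1 : ℝ) ≤ n := by exact_mod_cast hn
  have hM0 : 0 ≤ M := (abs_nonneg _).trans (hM ⟨0, Or.inl (Or.inr fun i => by simp)⟩)
  have hbound : ∀ η : ℤ, |∑ x ∈ sectionFinset d n η, ψ x| ≤ M * (3 * n) ^ (d - 1) := by
    intro η
    calc |∑ x ∈ sectionFinset d n η, ψ x| ≤ ∑ x ∈ sectionFinset d n η, |ψ x| :=
          Finset.abs_sum_le_sum_abs _ _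
      _ ≤ ∑ _x ∈ sectionFinset d n η, M := Finset.sum_le_sum fun x _ => hM x
      _ = M * (sectionFinset d n η).card := by rw [Finset.sum_const, nsmul_eq_mul, mul_comm]
      _ ≤ M * (2 * n + 1) ^ (d - 1) := by
          gcongr
          exact_mod_cast card_sectionFinset_le (d := d) (n := n) η
      -- Here `1 ≤ n` gives `2 n + 1 ≤ 3 n`, the source of the factor `3 ^ (d - 1)`.
      _ ≤ M * (3 * n) ^ (d - 1) := by gcongr; linarith
  have h1 : n * |flux ψ ξ| ≤ 2 * M * (3 * n) ^ (d - 1) := by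
    rw [flux_eq_flux_zero hψ hξ, ← Nat.abs_cast n, ← abs_mul, Nat.abs_cast,
      ← sum_sectionFinset_sub_top hψ hn]
    have := (abs_sub _ _).trans (add_le_add (hbound 0) (hbound n))
    linarith
  rw [div_le_div_iff₀ (by positivity) (by positivity)]
  rw [mul_pow] at h1
  linarith

end Flux

/-! ### A unit flow of finite energy on `ℕ³` -/

section Orthant

/-- Abel summation in one coordinate direction. -/
lemma sum_range_mul_sub (t f : ℕ → ℝ) (M : ℕ) (h0 : t 0 = 0) (hM : f M = 0) :
    ∑ a ∈ Finset.range M, t (a + 1) * (f a - f (a + 1)) =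
      ∑ a ∈ Finset.range M, (t (a + 1) - t a) * f a := by
  have h : ∀ M, ∑ a ∈ Finset.range M, t (a + 1) * (f a - f (a + 1)) =
      ∑ a ∈ Finset.range M, (t (a + 1) - t a) * f a - t M * f M := by
    intro M
    induction M with
    | zero => simp [h0]
    | succ M ih => rw [Finset.sum_range_succ, Finset.sum_range_succ, ih]; ring
  rw [h, hM]; ring

/-- The flow on the orthant `ℕ³` generated by Pólya's urn: the edge leading in coordinate
direction `i` to a vertex whose `i`-th coordinate is `a`, at level `m`, carries `urnFlow m a`. -/
noncomputable def urnFlow (m a : ℕ) : ℝ := 2 * a / (m * (m + 1) * (m + 2))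

/-- Starting with one ball of each of three colours, the urn is uniform on the `(m + 1) (m + 2) / 2`
points of level `m` and adds colour `a` with probability `(a + 1) / (m + 3)`. Conservation of
probability is the divergence identity; at the corner the inflow `0 / 0` is `0`, leaving a unit
source. -/
lemma urnFlow_divergence (a b c : ℕ) :
    (urnFlow (a + b + c + 1) (a + 1) - urnFlow (a + b + c) a) +
      (urnFlow (a + b + c + 1) (b + 1) - urnFlow (a + b + c) b) +
      (urnFlow (a + b + c + 1) (c + 1) - urnFlow (a + b + c) c) =
    if a = 0 ∧ b = 0 ∧ c = 0 then 1 else 0 := by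
  unfold urnFlow
  split_ifs with h
  · obtain ⟨rfl, rfl, rfl⟩ := h
    norm_num
  · have hm : (0 : ℝ) < a + b + c := by
      have : 0 < a + b + c := by omega
      exact_mod_cast this
    push_cast
    field_simp
    ring

/-- The vertices of a box in `ℕ³`. -/
def box (M : ℕ) : Finset (ℕ × ℕ × ℕ) := Finset.range M ×ˢ Finset.range M ×ˢ Finset.range M

/-- The decrements of `f` in the three coordinate directions. -/
def orthantDiff (f : ℕ × ℕ × ℕ → ℝ) (p : ℕ × ℕ × ℕ) : Fin 3 → ℝ
  | 0 => f p - f (p.1 + 1, p.2.1, p.2.2)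
  | 1 => f p - f (p.1, p.2.1 + 1, p.2.2)
  | 2 => f p - f (p.1, p.2.1, p.2.2 + 1)

/-- The flow out of the vertex `p` in the three coordinate directions. -/
noncomputable def urnOutflow (p : ℕ × ℕ × ℕ) : Fin 3 → ℝ
  | 0 => urnFlow (p.1 + p.2.1 + p.2.2 + 1) (p.1 + 1)
  | 1 => urnFlow (p.1 + p.2.1 + p.2.2 + 1) (p.2.1 + 1)
  | 2 => urnFlow (p.1 + p.2.1 + p.2.2 + 1) (p.2.2 + 1)

/-- Abel summation moves the differences from `f` to the flow, whose divergence is a unit mass at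
the corner. Boundary terms vanish because `urnFlow m 0 = 0` and `f` is zero outside the box. -/
lemma sum_box_urnOutflow (f : ℕ × ℕ × ℕ → ℝ) {M : ℕ}
    (hf : ∀ a b c, M ≤ a ∨ M ≤ b ∨ M ≤ c → f (a, b, c) = 0) :
    f 0 = ∑ p ∈ box M, ∑ i, urnOutflow p i * orthantDiff f p i := by
  have e1 : ∑ p ∈ box M, urnOutflow p 0 * orthantDiff f p 0 =
      ∑ p ∈ box M, (urnFlow (p.1 + p.2.1 + p.2.2 + 1) (p.1 + 1) -
        urnFlow (p.1 + p.2.1 + p.2.2) p.1) * f p := by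
    unfold box
    refine (Finset.sum_product_right _ _ _).trans
      (Eq.trans (Finset.sum_congr rfl fun q _ => ?_) (Finset.sum_product_right _ _ _).symm)
    have h := sum_range_mul_sub (fun a => urnFlow (a + q.1 + q.2) a) (fun a => f (a, q)) M
      (by simp [urnFlow]) (hf _ _ _ (Or.inl le_rfl))
    simp only [add_right_comm _ 1] at h
    exact h
  have e2 : ∑ p ∈ box M, urnOutflow p 1 * orthantDiff f p 1 =
      ∑ p ∈ box M, (urnFlow (p.1 + p.2.1 + p.2.2 + 1) (p.2.1 + 1) -
        urnFlow (p.1 + p.2.1 + p.2.2) p.2.1) * f p := by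
    unfold box
    rw [Finset.sum_product, Finset.sum_product]
    refine Finset.sum_congr rfl fun a _ => ?_
    rw [Finset.sum_product_right, Finset.sum_product_right]
    refine Finset.sum_congr rfl fun c _ => ?_
    have h := sum_range_mul_sub (fun b => urnFlow (a + b + c) b) (fun b => f (a, b, c)) M
      (by simp [urnFlow]) (hf _ _ _ (Or.inr (Or.inl le_rfl)))
    simp only [← add_assoc, add_right_comm _ 1] at h
    exact h
  have e3 : ∑ p ∈ box M, urnOutflow p 2 * orthantDiff f p 2 =
      ∑ p ∈ box M, (urnFlow (p.1 + p.2.1 + p.2.2 + 1) (p.2.2 + 1) -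
        urnFlow (p.1 + p.2.1 + p.2.2) p.2.2) * f p := by
    unfold box
    simp only [Finset.sum_product]
    refine Finset.sum_congr rfl fun a _ => Finset.sum_congr rfl fun b _ => ?_
    exact sum_range_mul_sub (fun c => urnFlow (a + b + c) c) (fun c => f (a, b, c)) M
      (by simp [urnFlow]) (hf _ _ _ (Or.inr (Or.inr le_rfl)))
  simp only [Fin.sum_univ_three, Finset.sum_add_distrib]
  rw [e1, e2, e3, ← Finset.sum_add_distrib, ← Finset.sum_add_distrib]
  simp only [← add_mul, urnFlow_divergence]
  rw [Finset.sum_eq_single 0]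
  · simp
  · rintro ⟨a, b, c⟩ _ hp
    rw [if_neg, zero_mul]
    rintro ⟨rfl, rfl, rfl⟩
    exact hp rfl
  · intro h
    have hM : M = 0 := by
      by_contra hM
      exact h (by simp [box, Nat.pos_of_ne_zero hM])
    subst hM
    have h0 : f 0 = 0 := hf 0 0 0 (Or.inl le_rfl)
    rw [h0, mul_zero]

/-- With `s = a + b + c + 1` the sum is at most `4 / s ^ 4`. Splitting `4 = 3 · (4 / 3)` and using
that `s` dominates each of `a + 1`, `b + 1`, `c + 1` gives a product of three terms of convergent
series, as `4 / 3 > 1`. -/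
lemma sum_sq_urnOutflow_le (a b c : ℕ) :
    ∑ i, urnOutflow (a, b, c) i ^ 2 ≤
      4 * (((a : ℝ) + 1) ^ (-(4 / 3 : ℝ)) *
        (((b : ℝ) + 1) ^ (-(4 / 3 : ℝ)) * ((c : ℝ) + 1) ^ (-(4 / 3 : ℝ)))) := by
  have ha : (0 : ℝ) ≤ a := a.cast_nonneg
  have hb : (0 : ℝ) ≤ b := b.cast_nonneg
  have hc : (0 : ℝ) ≤ c := c.cast_nonneg
  set s : ℝ := a + b + c + 1 with hs
  have hs1 : 1 ≤ s := by linarith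
  have hs0 : 0 < s := by linarith
  have h1 : ∑ i, urnOutflow (a, b, c) i ^ 2 ≤ 4 / s ^ 4 := by
    have heq : ∑ i, urnOutflow (a, b, c) i ^ 2 =
        4 * (((a : ℝ) + 1) ^ 2 + (b + 1) ^ 2 + (c + 1) ^ 2) / (s * (s + 1) * (s + 2)) ^ 2 := by
      simp only [Fin.sum_univ_three, urnOutflow, urnFlow]
      push_cast
      rw [← hs]
      field_simp
      ring
    rw [heq, div_le_div_iff₀ (by positivity) (by positivity)]
    have h2 : ((a : ℝ) + 1) ^ 2 + (b + 1) ^ 2 + (c + 1) ^ 2 ≤ (s + 2) ^ 2 := by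
      have : s + 2 = (a + 1) + (b + 1) + (c + 1) := by rw [hs]; ring
      rw [this]
      nlinarith [mul_nonneg ha hb, mul_nonneg ha hc, mul_nonneg hb hc]
    calc 4 * (((a : ℝ) + 1) ^ 2 + (b + 1) ^ 2 + (c + 1) ^ 2) * s ^ 4
        ≤ 4 * (s + 2) ^ 2 * s ^ 4 := by gcongr
      _ ≤ 4 * (s + 2) ^ 2 * (s ^ 2 * (s + 1) ^ 2) := by
          have : s ^ 4 = s ^ 2 * s ^ 2 := by ring
          rw [this]
          gcongr
          linarith
      _ = 4 * (s * (s + 1) * (s + 2)) ^ 2 := by ring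
  refine h1.trans ?_
  rw [div_eq_mul_inv]
  refine mul_le_mul_of_nonneg_left ?_ (by norm_num)
  have h3 : (s ^ 4)⁻¹ = s ^ (-(4 / 3 : ℝ)) * (s ^ (-(4 / 3 : ℝ)) * s ^ (-(4 / 3 : ℝ))) := by
    rw [← Real.rpow_add hs0, ← Real.rpow_add hs0, ← Real.rpow_natCast, ← Real.rpow_neg hs0.le]
    norm_num
  rw [h3]
  have hmono : ∀ x : ℝ, 0 ≤ x → x + 1 ≤ s → s ^ (-(4 / 3 : ℝ)) ≤ (x + 1) ^ (-(4 / 3 : ℝ)) :=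
    fun x hx hxs => Real.rpow_le_rpow_of_nonpos (by linarith) hxs (by norm_num)
  have h4 := hmono a ha (by linarith)
  have h5 := hmono b hb (by linarith)
  have h6 := hmono c hc (by linarith)
  have h7 : (0 : ℝ) ≤ s ^ (-(4 / 3 : ℝ)) := by positivity
  exact mul_le_mul h4 (mul_le_mul h5 h6 h7 (h7.trans h5)) (mul_nonneg h7 h7) (h7.trans h4)

/-- The urn flow has finite energy. -/
lemma exists_urn_energy_bound : ∃ C : ℝ, 0 ≤ C ∧
    ∀ M, ∑ p ∈ box M, ∑ i, urnOutflow p i ^ 2 ≤ C := by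
  have hsum : Summable fun a : ℕ => ((a : ℝ) + 1) ^ (-(4 / 3 : ℝ)) := by
    have h := (summable_nat_add_iff 1).2
      (Real.summable_nat_rpow (p := -(4 / 3 : ℝ)).2 (by norm_num))
    simpa using h
  set Z : ℝ := ∑' a : ℕ, ((a : ℝ) + 1) ^ (-(4 / 3 : ℝ)) with hZ
  have hpos : ∀ a : ℕ, 0 ≤ ((a : ℝ) + 1) ^ (-(4 / 3 : ℝ)) := fun a => by positivity
  have hZ0 : 0 ≤ Z := tsum_nonneg hpos
  refine ⟨4 * (Z * (Z * Z)), by positivity, fun M => ?_⟩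
  set r : ℝ := ∑ a ∈ Finset.range M, ((a : ℝ) + 1) ^ (-(4 / 3 : ℝ)) with hr
  have hr0 : 0 ≤ r := Finset.sum_nonneg fun a _ => hpos a
  have hrZ : r ≤ Z := hsum.sum_le_tsum _ fun a _ => hpos a
  calc ∑ p ∈ box M, ∑ i, urnOutflow p i ^ 2
      ≤ ∑ p ∈ box M, 4 * (((p.1 : ℝ) + 1) ^ (-(4 / 3 : ℝ)) *
        (((p.2.1 : ℝ) + 1) ^ (-(4 / 3 : ℝ)) * ((p.2.2 : ℝ) + 1) ^ (-(4 / 3 : ℝ)))) :=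
        Finset.sum_le_sum fun p _ => sum_sq_urnOutflow_le p.1 p.2.1 p.2.2
    _ = 4 * (r * (r * r)) := by
        rw [← Finset.mul_sum, hr]
        congr 1
        simp only [box, Finset.sum_product, ← Finset.mul_sum, ← Finset.sum_mul]
    _ ≤ 4 * (Z * (Z * Z)) := by gcongr

/-- The Dirichlet energy controls the value at the corner of the orthant. -/
lemma exists_sq_le_orthant_energy : ∃ C : ℝ, 0 ≤ C ∧ ∀ (f : ℕ × ℕ × ℕ → ℝ) (M : ℕ),
    (∀ a b c, M ≤ a ∨ M ≤ b ∨ M ≤ c → f (a, b, c) = 0) →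
      f 0 ^ 2 ≤ C * ∑ p ∈ box M, ∑ i, orthantDiff f p i ^ 2 := by
  obtain ⟨C, hC, hE⟩ := exists_urn_energy_bound
  refine ⟨C, hC, fun f M hf => ?_⟩
  rw [sum_box_urnOutflow f hf]
  simp only [← Finset.sum_product'] at hE ⊢
  refine (Finset.sum_mul_sq_le_sq_mul_sq _ _ _).trans ?_
  exact mul_le_mul_of_nonneg_right (hE M) (Finset.sum_nonneg fun _ _ => sq_nonneg _)

end Orthant

/-! ### The Dirichlet energy -/

section Energy

variable {d n : ℕ} [NeZero d]

/-- The Dirichlet energy, every edge being counted in both directions. -/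
noncomputable def energy (f : domain d n → ℝ) : ℝ :=
  ∑' p : domain d n × Direction d, (f (move p.1 p.2) - f p.1) ^ 2

lemma finite_setOf_fst_mem {S : Set (domain d n)} (hS : S.Finite) :
    {p : domain d n × Direction d | p.1 ∈ S}.Finite :=
  (hS.prod Set.finite_univ).subset fun _ hp => ⟨hp, Set.mem_univ _⟩

lemma finite_setOf_move_mem {S : Set (domain d n)} (hS : S.Finite) :
    {p : domain d n × Direction d | move p.1 p.2 ∈ S}.Finite :=
  (finite_setOf_fst_mem hS).preimage (f := reverseJump) reverseJump_involutive.injective.injOn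

lemma summable_of_fst {f : domain d n → ℝ} (hf : f.support.Finite)
    {F : domain d n × Direction d → ℝ} (hF : ∀ p, f p.1 = 0 → F p = 0) : Summable F :=
  summable_of_hasFiniteSupport <| (finite_setOf_fst_mem hf).subset fun p hp h => hp (hF p h)

lemma summable_energy {f : domain d n → ℝ} (hf : f.support.Finite) :
    Summable fun p : domain d n × Direction d => (f (move p.1 p.2) - f p.1) ^ 2 := by
  refine summable_of_hasFiniteSupport
    (((finite_setOf_fst_mem hf).union (finite_setOf_move_mem hf)).subset fun p hp => ?_)
  by_contra h
  simp only [Set.mem_union, Set.mem_ofPred_eq, Function.mem_support, not_or, not_not] at h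
  exact hp (by simp [h.1, h.2])

lemma sum_sq_le_energy {f : domain d n → ℝ} (hf : f.support.Finite)
    (S : Finset (domain d n × Direction d)) :
    ∑ p ∈ S, (f (move p.1 p.2) - f p.1) ^ 2 ≤ energy f :=
  (summable_energy hf).sum_le_tsum S fun _ _ => sq_nonneg _

/-- Summation by parts: `reverseJump` permutes the directed jumps and exchanges endpoints, so the
squares at the two ends have the same sum. Finite support makes every series summable. -/
lemma energy_eq {f : domain d n → ℝ} (hf : f.support.Finite) :
    energy f = 2 * ∑' x, f x * (2 * (d : ℝ) * f x - ∑ e, f (move x e)) := by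
  let τ : Equiv.Perm (domain d n × Direction d) := reverseJump_involutive.toPerm
  let F : domain d n × Direction d → ℝ := fun p => f p.1 ^ 2
  let H : domain d n × Direction d → ℝ := fun p => f p.1 * f (move p.1 p.2)
  have hF : Summable F := summable_of_fst hf fun p hp => by simp [F, hp]
  have hH : Summable H := summable_of_fst hf fun p hp => by simp [H, hp]
  have hFτ : Summable fun p => F (τ p) := τ.summable_iff.2 hF
  have h1 : energy f = ∑' p, (F (τ p) + F p - 2 * H p) := by
    refine tsum_congr fun p => ?_
    change _ = f (reverseJump p).1 ^ 2 + f p.1 ^ 2 - 2 * (f p.1 * f (move p.1 p.2))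
    rw [reverseJump_fst]; ring
  have h2 : ∑' p, (F p - H p) = ∑' x, f x * (2 * (d : ℝ) * f x - ∑ e, f (move x e)) := by
    rw [(hF.sub hH).tsum_prod]
    refine tsum_congr fun x => ?_
    rw [tsum_fintype, Finset.sum_sub_distrib]
    simp only [F, H, ← Finset.mul_sum, Finset.sum_const, Finset.card_univ, Fintype.card_prod, Fintype.card_fin,
      Fintype.card_bool, nsmul_eq_mul]
    push_cast
    ring
  rw [h1, (hFτ.add hF).tsum_sub (hH.mul_left 2), hFτ.tsum_add hF, τ.tsum_eq, tsum_mul_left, ← h2,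
    hF.tsum_sub hH]
  ring

/-- Point evaluation at `x` is bounded by the Dirichlet energy. -/
def EnergyBounded (x : domain d n) : Prop :=
  ∃ C : ℝ, 0 ≤ C ∧ ∀ f : domain d n → ℝ, f.support.Finite → f x ^ 2 ≤ C * energy f

lemma EnergyBounded.of_move {x : domain d n} {e : Direction d} (h : EnergyBounded (move x e)) :
    EnergyBounded x := by
  obtain ⟨C, hC, h⟩ := h
  refine ⟨2 * C + 2, by positivity, fun f hf => ?_⟩
  have h1 := h f hf
  have h2 := sum_sq_le_energy hf {(x, e)}
  rw [Finset.sum_singleton] at h2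
  -- With `y = move x e`, the hint is `f x ^ 2 ≤ 2 * f y ^ 2 + 2 * (f y - f x) ^ 2`.
  nlinarith [sq_nonneg (2 * f (move x e) - f x)]

end Energy

/-! ### Energy bounds for point evaluations -/

section Base

variable {d n : ℕ} [NeZero d]

/-- The centre of the right mouth of the channel. -/
def mouth (d n : ℕ) [NeZero d] : domain d n :=
  ⟨Pi.single 0 (n : ℤ), Or.inl (Or.inl (by simp [rightHalf]))⟩

/-- The orthant with corner at the mouth of the channel, in the first three coordinates. -/
def orthant (hd : 3 ≤ d) (n : ℕ) (p : ℕ × ℕ × ℕ) : domain d n :=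
  ⟨Pi.single 0 (n : ℤ) + Pi.single (Fin.castLE hd 0) (p.1 : ℤ) +
      Pi.single (Fin.castLE hd 1) (p.2.1 : ℤ) + Pi.single (Fin.castLE hd 2) (p.2.2 : ℤ), by
    refine Or.inl (Or.inl ?_)
    have h : ∀ (i : Fin d) (k : ℕ), 0 ≤ (Pi.single i (k : ℤ) : Fin d → ℤ) 0 := fun i k =>
      (Pi.single_nonneg.2 (Int.natCast_nonneg k) : (0 : Fin d → ℤ) ≤ _) 0
    have h0 := h (Fin.castLE hd 0) p.1
    have h1 := h (Fin.castLE hd 1) p.2.1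
    have h2 := h (Fin.castLE hd 2) p.2.2
    simp only [rightHalf, Set.mem_ofPred_eq, Pi.add_apply, Pi.single_eq_same]
    omega⟩

lemma orthant_zero (hd : 3 ≤ d) : orthant hd n 0 = mouth d n :=
  Subtype.ext (by simp [orthant, mouth])

lemma castLE_zero_eq (hd : 3 ≤ d) : Fin.castLE hd 0 = (0 : Fin d) := Fin.ext (by simp)

lemma orthant_injective (hd : 3 ≤ d) : Function.Injective (orthant hd n) := by
  rintro ⟨a, b, c⟩ ⟨a', b', c'⟩ h
  have h' : ∀ i, _ := fun i => congrFun (Subtype.ext_iff.1 h) i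
  have h10 : Fin.castLE hd 1 ≠ (0 : Fin d) := by simp [Fin.ext_iff]
  have h20 : Fin.castLE hd 2 ≠ (0 : Fin d) := by simp [Fin.ext_iff]
  have h12 : Fin.castLE hd 1 ≠ Fin.castLE hd 2 := by simp [Fin.ext_iff]
  have e0 := h' 0
  have e1 := h' (Fin.castLE hd 1)
  have e2 := h' (Fin.castLE hd 2)
  simp only [orthant, castLE_zero_eq, Pi.add_apply, Pi.single_eq_same, Pi.single_eq_of_ne h10,
    Pi.single_eq_of_ne h20, Pi.single_eq_of_ne h12, Pi.single_eq_of_ne h10.symm,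
    Pi.single_eq_of_ne h20.symm, Pi.single_eq_of_ne h12.symm] at e0 e1 e2
  simp only [Prod.mk.injEq]
  omega

lemma move_orthant (hd : 3 ≤ d) (p : ℕ × ℕ × ℕ) :
    move (orthant hd n p) (Fin.castLE hd 0, true) = orthant hd n (p.1 + 1, p.2.1, p.2.2) ∧
    move (orthant hd n p) (Fin.castLE hd 1, true) = orthant hd n (p.1, p.2.1 + 1, p.2.2) ∧
    move (orthant hd n p) (Fin.castLE hd 2, true) = orthant hd n (p.1, p.2.1, p.2.2 + 1) := by
  have key : ∀ (e : Direction d) (q : ℕ × ℕ × ℕ),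
      (orthant hd n p : Fin d → ℤ) + e.vec = orthant hd n q →
        move (orthant hd n p) e = orthant hd n q := by
    intro e q h
    have hm : (orthant hd n p : Fin d → ℤ) + e.vec ∈ domain d n := by rw [h]; exact Subtype.prop _
    rw [move_of_mem hm]
    exact Subtype.ext h
  refine ⟨key _ _ ?_, key _ _ ?_, key _ _ ?_⟩ <;>
  · simp only [orthant, Direction.vec, if_true]
    push_cast
    rw [Pi.single_add]
    abel

/-- The orthant embeds in the right half-lattice with its edges mapped to distinct jumps, so its
energy is a partial sum of `energy f`. -/
lemma energyBounded_mouth (hd : 3 ≤ d) : EnergyBounded (mouth d n) := by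
  obtain ⟨C, hC, h⟩ := exists_sq_le_orthant_energy
  refine ⟨C, hC, fun f hf => ?_⟩
  obtain ⟨⟨A, B, D⟩, hub⟩ : BddAbove {p | f (orthant hd n p) ≠ 0} :=
    (hf.preimage (orthant_injective hd).injOn).bddAbove
  have hzero : ∀ a b c, A + B + D + 1 ≤ a ∨ A + B + D + 1 ≤ b ∨ A + B + D + 1 ≤ c →
      f (orthant hd n (a, b, c)) = 0 := by
    intro a b c habc
    by_contra hne
    have hle : (a, b, c) ≤ (A, B, D) := hub hne
    simp only [Prod.mk_le_mk] at hle
    omega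
  have h1 := h (fun p => f (orthant hd n p)) (A + B + D + 1) hzero
  rw [orthant_zero] at h1
  refine h1.trans (mul_le_mul_of_nonneg_left ?_ hC)
  classical
  let g : (ℕ × ℕ × ℕ) × Fin 3 → domain d n × Direction d :=
    fun q => (orthant hd n q.1, (Fin.castLE hd q.2, true))
  have hg : Function.Injective g := by
    rintro ⟨p, i⟩ ⟨q, j⟩ hpq
    simp only [g, Prod.mk.injEq, and_true] at hpq
    rw [orthant_injective hd hpq.1, Fin.castLE_injective hd hpq.2]
  have hdiff : ∀ p i, orthantDiff (fun p => f (orthant hd n p)) p i ^ 2 =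
      (f (move (g (p, i)).1 (g (p, i)).2) - f (g (p, i)).1) ^ 2 := by
    intro p i
    obtain ⟨m0, m1, m2⟩ := move_orthant (n := n) hd p
    rw [sub_sq_comm]
    fin_cases i
    · exact congrArg (fun z => (f (orthant hd n p) - f z) ^ 2) m0.symm
    · exact congrArg (fun z => (f (orthant hd n p) - f z) ^ 2) m1.symm
    · exact congrArg (fun z => (f (orthant hd n p) - f z) ^ 2) m2.symm
  simp only [hdiff]
  rw [← Finset.sum_product', ← Finset.sum_image (s := box _ ×ˢ Finset.univ) (g := g)
    (f := fun p => (f (move p.1 p.2) - f p.1) ^ 2) hg.injOn]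
  exact sum_sq_le_energy hf _

/-- The `ℓ¹` distance to the mouth of the channel. -/
def mouthDist (x : domain d n) : ℕ :=
  ∑ i, ((x : Fin d → ℤ) i - (mouth d n : Fin d → ℤ) i).natAbs

lemma mouthDist_move_lt {x : domain d n} {i : Fin d} {b : Bool}
    (hm : (x : Fin d → ℤ) + Direction.vec (i, b) ∈ domain d n)
    (h : ((x : Fin d → ℤ) i + (if b then 1 else -1) - (mouth d n : Fin d → ℤ) i).natAbs <
      ((x : Fin d → ℤ) i - (mouth d n : Fin d → ℤ) i).natAbs) :
    mouthDist (move x (i, b)) < mouthDist x := by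
  have hi : (move x (i, b) : Fin d → ℤ) i = (x : Fin d → ℤ) i + if b then 1 else -1 := by
    rw [move_of_mem hm]
    simp [Direction.vec]
  refine Finset.sum_lt_sum (fun j _ => ?_) ⟨i, Finset.mem_univ i, by rw [hi]; exact h⟩
  by_cases hj : j = i
  · subst hj
    rw [hi]; exact h.le
  · rw [move_apply_of_ne x (i, b) hj]

/-- Shrinking a non-zero transverse coordinate never leaves the domain. Once all of them vanish, the
site is on the first axis, which lies entirely in the domain. -/
lemma exists_mouthDist_move_lt {x : domain d n} (hx : x ≠ mouth d n) :
    ∃ e, mouthDist (move x e) < mouthDist x := by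
  by_cases h : ∃ i : Fin d, i ≠ 0 ∧ (x : Fin d → ℤ) i ≠ 0
  · obtain ⟨i, hi, hxi⟩ := h
    have hmi : (mouth d n : Fin d → ℤ) i = 0 := by simp [mouth, hi]
    have hv : ∀ b, ((x : Fin d → ℤ) + Direction.vec (i, b)) 0 = (x : Fin d → ℤ) 0 := fun b => by
      simp [Direction.vec, hi.symm]
    have hdom : ∀ b : Bool, ((x : Fin d → ℤ) i + if b then 1 else -1).natAbs <
        ((x : Fin d → ℤ) i).natAbs → (x : Fin d → ℤ) + Direction.vec (i, b) ∈ domain d n := by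
      intro b hb
      rcases x.2 with (hr | hc) | hl
      · refine Or.inl (Or.inl ?_)
        rw [rightHalf, Set.mem_ofPred_eq, hv]; exact hr
      · refine Or.inl (Or.inr fun j => ?_)
        by_cases hj : j = i
        · subst hj
          have h1 := hc j
          have h2 : ((x : Fin d → ℤ) + Direction.vec (j, b)) j =
              (x : Fin d → ℤ) j + if b then 1 else -1 := by simp [Direction.vec]
          rw [h2, Int.abs_eq_natAbs]
          rw [Int.abs_eq_natAbs] at h1
          omega
        · simpa [Direction.vec, hj] using hc j
      · refine Or.inr ?_
        rw [leftHalf, Set.mem_ofPred_eq, hv]; exact hl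
    obtain ⟨b, hb⟩ : ∃ b : Bool, ((x : Fin d → ℤ) i + if b then 1 else -1).natAbs <
        ((x : Fin d → ℤ) i).natAbs := by
      rcases lt_or_gt_of_ne hxi with h0 | h0
      · exact ⟨true, by rw [if_pos rfl]; omega⟩
      · exact ⟨false, by simp only [Bool.false_eq_true, if_false]; omega⟩
    exact ⟨(i, b), mouthDist_move_lt (hdom b hb) (by simpa [hmi] using hb)⟩
  · push Not at h
    have hm0 : (mouth d n : Fin d → ℤ) 0 = n := by simp [mouth]
    have hx0 : (x : Fin d → ℤ) 0 ≠ n := by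
      refine fun h0 => hx (Subtype.ext (funext fun i => ?_))
      by_cases hi : i = 0
      · subst hi; rw [h0, hm0]
      · rw [h i hi]; simp [mouth, hi]
    have hdom : ∀ b : Bool, (x : Fin d → ℤ) + Direction.vec (0, b) ∈ domain d n := by
      intro b
      have hx' : (x : Fin d → ℤ) + Direction.vec (0, b) =
          Function.update (0 : Fin d → ℤ) 0 ((x : Fin d → ℤ) 0 + if b then 1 else -1) := by
        rw [add_vec_zero]
        ext i
        by_cases hi : i = 0
        · subst hi; simp
        · simp [hi, h i hi]
      rw [hx']
      exact mem_domain_of_update (fun i => by simp) _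
    rcases lt_or_gt_of_ne hx0 with h0 | h0
    · exact ⟨(0, true), mouthDist_move_lt (hdom _) (by rw [hm0, if_pos rfl]; omega)⟩
    · exact ⟨(0, false), mouthDist_move_lt (hdom _)
        (by rw [hm0]; simp only [Bool.false_eq_true, if_false]; omega)⟩

lemma energyBounded (hd : 3 ≤ d) (x : domain d n) : EnergyBounded x := by
  induction hk : mouthDist x using Nat.strong_induction_on generalizing x with
  | _ k ih =>
    by_cases hx : x = mouth d n
    · rw [hx]; exact energyBounded_mouth hd
    · obtain ⟨e, he⟩ := exists_mouthDist_move_lt hx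
      exact (ih _ (hk ▸ he) _ rfl).of_move

end Base

/-! ### Truncated Green functions and transience -/

section Green

variable {d n : ℕ} [NeZero d]

/-- The expected number of visits to `y` before ring number `N`. -/
noncomputable def greenSum (y : domain d n) (N : ℕ) (x : domain d n) : ℝ :=
  ∑ k ∈ Finset.range N, skeletonProb {y} k x

lemma finite_support_skeletonProb (y : domain d n) (k : ℕ) :
    (Function.support (skeletonProb {y} k)).Finite := by
  induction k with
  | zero =>
    refine (Set.finite_singleton y).subset fun x hx => ?_
    by_contra h
    exact hx (by rw [skeletonProb_zero, if_neg h])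
  | succ k ih =>
    refine ((finite_setOf_move_mem ih).image Prod.fst).subset fun x hx => ?_
    by_contra h
    have hz : ∀ e, skeletonProb {y} k (move x e) = 0 := fun e => by
      by_contra he
      exact h ⟨(x, e), he, rfl⟩
    have h1 := sum_skeletonProb {y} k x
    rw [Finset.sum_eq_zero fun e _ => hz e] at h1
    exact (mul_ne_zero (two_mul_pos d).ne' hx) h1.symm

lemma finite_support_greenSum (y : domain d n) (N : ℕ) :
    (Function.support (greenSum y N)).Finite := by
  refine (Set.Finite.biUnion (Finset.range N).finite_toSet
    fun k _ => finite_support_skeletonProb y k).subset ?_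
  intro x hx
  obtain ⟨k, hk, hne⟩ := Finset.exists_ne_zero_of_sum_ne_zero hx
  exact Set.mem_biUnion hk hne

lemma greenSum_nonneg (y : domain d n) (N : ℕ) (x : domain d n) : 0 ≤ greenSum y N x :=
  Finset.sum_nonneg fun k _ => skeletonProb_nonneg _ k x

lemma greenSum_sub_sum (y : domain d n) (N : ℕ) (x : domain d n) :
    2 * (d : ℝ) * greenSum y N x - ∑ e, greenSum y N (move x e) =
      2 * (d : ℝ) * (skeletonProb {y} 0 x - skeletonProb {y} N x) := by
  unfold greenSum
  rw [Finset.sum_comm]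
  simp only [sum_skeletonProb]
  rw [← Finset.mul_sum, ← mul_sub, ← Finset.sum_sub_distrib,
    Finset.sum_range_sub' fun k => skeletonProb {y} k x]

/-- By telescoping, `-G` of `greenSum y N` is `2 d` times the unit mass at `y` minus the law after
`N` rings. The subtracted term only lowers the energy, `greenSum` being non-negative. -/
lemma energy_greenSum_le (y : domain d n) (N : ℕ) :
    energy (greenSum y N) ≤ 4 * (d : ℝ) * greenSum y N y := by
  have hfin := finite_support_greenSum y N
  have hS : ∀ F : domain d n → ℝ, (∀ x, greenSum y N x = 0 → F x = 0) → Summable F :=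
    fun F hF => summable_of_hasFiniteSupport (hfin.subset fun x hx h => hx (hF x h))
  have h1 : ∑' x, greenSum y N x * (2 * (d : ℝ) * (skeletonProb {y} 0 x - skeletonProb {y} N x)) ≤
      ∑' x, greenSum y N x * (2 * (d : ℝ) * skeletonProb {y} 0 x) := by
    refine Summable.tsum_le_tsum (fun x => ?_) (hS _ fun x hx => by simp [hx])
      (hS _ fun x hx => by simp [hx])
    refine mul_le_mul_of_nonneg_left (mul_le_mul_of_nonneg_left ?_ (two_mul_pos d).le)
      (greenSum_nonneg y N x)
    linarith [skeletonProb_nonneg {y} N x]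
  have h2 : ∑' x, greenSum y N x * (2 * (d : ℝ) * skeletonProb {y} 0 x) =
      greenSum y N y * (2 * (d : ℝ)) := by
    rw [tsum_eq_single y]
    · simp [skeletonProb_zero]
    · intro x hx
      simp [skeletonProb_zero, hx]
  rw [energy_eq hfin]
  simp only [greenSum_sub_sum]
  linarith

lemma exists_greenSum_le (hd : 3 ≤ d) (x y : domain d n) : ∃ B, ∀ N, greenSum y N x ≤ B := by
  obtain ⟨Cx, hCx, hx⟩ := energyBounded hd x
  obtain ⟨Cy, hCy, hy⟩ := energyBounded hd y
  have hd0 : (0 : ℝ) ≤ 4 * d := by positivity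
  -- At the pole the bound is quadratic against linear, so one factor cancels. At `x` only the
  -- square is bounded, and `t ≤ t ^ 2 + 1` avoids a square root.
  refine ⟨Cx * (4 * d * (Cy * (4 * d))) + 1, fun N => ?_⟩
  have hfin := finite_support_greenSum y N
  have hE := energy_greenSum_le y N
  have hyN := greenSum_nonneg y N y
  have h1 : greenSum y N y ≤ Cy * (4 * d) := by
    have h := (hy _ hfin).trans (mul_le_mul_of_nonneg_left hE hCy)
    rcases hyN.eq_or_lt with h0 | h0
    · rw [← h0]; positivity
    · refine le_of_mul_le_mul_right ?_ h0
      linarith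
  have h2 : greenSum y N x ^ 2 ≤ Cx * (4 * d * (Cy * (4 * d))) :=
    (hx _ hfin).trans (mul_le_mul_of_nonneg_left
      (hE.trans (mul_le_mul_of_nonneg_left h1 hd0)) hCx)
  nlinarith [sq_nonneg (greenSum y N x - 1)]

/-- In dimension at least three the walk visits every site finitely often. -/
lemma ae_eventually_skeleton_ne (hd : 3 ≤ d) (x y : domain d n) :
    ∀ᵐ ω ∂sampleMeasure d, ∀ᶠ k in atTop, skeleton x ω k ≠ y := by
  obtain ⟨B, hB⟩ := exists_greenSum_le hd x y
  have hs : Summable fun k => skeletonProb {y} k x :=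
    summable_of_sum_range_le (fun k => skeletonProb_nonneg _ k x) hB
  have h : ∑' k, sampleMeasure d {ω | skeleton x ω k ∈ ({y} : Set (domain d n))} ≠ ⊤ := by
    have h1 : ∀ k, sampleMeasure d {ω | skeleton x ω k ∈ ({y} : Set (domain d n))} =
        ENNReal.ofReal (skeletonProb {y} k x) := fun k => by
      rw [skeletonProb, ofReal_measureReal]
    simp only [h1]
    exact hs.tsum_ofReal_ne_top
  exact ae_eventually_notMem h

end Green

/-! ### Escape to one of the half-lattices -/

section Escape

variable {d n : ℕ} [NeZero d]

lemma disjoint_rightSites_leftSites (hn : 1 ≤ n) : Disjoint (rightSites d n) (leftSites d n) := by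
  refine Set.disjoint_left.2 fun x hx hx' => ?_
  have h1 : (n : ℤ) ≤ (x : Fin d → ℤ) 0 := hx
  have h2 : (x : Fin d → ℤ) 0 ≤ -(n : ℤ) := hx'
  omega

lemma disjoint_eventuallyIn {A B : Set (domain d n)} (h : Disjoint A B) (x : domain d n) :
    Disjoint (eventuallyIn x A) (eventuallyIn x B) := by
  refine Set.disjoint_left.2 fun ω hA hB => ?_
  obtain ⟨k, hk, hk'⟩ := (Eventually.and hA hB).exists
  exact Set.disjoint_left.1 h hk hk'

lemma natAbs_move_sub_le (x : domain d n) (e : Direction d) (i : Fin d) :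
    ((move x e : Fin d → ℤ) i - (x : Fin d → ℤ) i).natAbs ≤ 1 := by
  by_cases h : (x : Fin d → ℤ) + e.vec ∈ domain d n
  · rw [move_of_mem h]
    obtain ⟨j, b⟩ := e
    by_cases hj : i = j
    · subst hj
      cases b <;> simp [Direction.vec]
    · simp [Direction.vec, hj]
  · simp [move_of_notMem h]

lemma finite_setOf_mem_channel :
    {x : domain d n | (x : Fin d → ℤ) ∈ channel d n}.Finite := by
  have h : (Set.pi Set.univ fun _ : Fin d => Set.Icc (-(n : ℤ)) n).Finite :=
    Set.Finite.pi fun _ => Set.finite_Icc _ _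
  exact (h.preimage Subtype.val_injective.injOn).subset fun x hx i _ => abs_le.1 (hx i)

/-- In dimension at least three the walk ends up in one of the two half-lattices. -/
lemma ae_eventuallyIn_or (hd : 3 ≤ d) (hn : 1 ≤ n) (x : domain d n) :
    ∀ᵐ ω ∂sampleMeasure d,
      ω ∈ eventuallyIn x (rightSites d n) ∨ ω ∈ eventuallyIn x (leftSites d n) := by
  have h : ∀ᵐ ω ∂sampleMeasure d, ∀ y ∈ {y : domain d n | (y : Fin d → ℤ) ∈ channel d n},
      ∀ᶠ k in atTop, skeleton x ω k ≠ y :=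
    (ae_ball_iff finite_setOf_mem_channel.countable).2
      fun y _ => ae_eventually_skeleton_ne hd x y
  filter_upwards [h] with ω hω
  obtain ⟨K, hK⟩ := eventually_atTop.1 ((eventually_all_finite finite_setOf_mem_channel).2 hω)
  have hside : ∀ k, K ≤ k →
      skeleton x ω k ∈ rightSites d n ∨ skeleton x ω k ∈ leftSites d n := by
    intro k hk
    rcases (skeleton x ω k).2 with (hr | hc) | hl
    · exact Or.inl hr
    · exact absurd rfl (hK k hk _ hc)
    · exact Or.inr hl
  -- The half-lattices are `2 n ≥ 2` apart in the first coordinate, so a unit step cannot change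
  -- sides.
  have hstep : ∀ k, ((skeleton x ω (k + 1) : Fin d → ℤ) 0 -
      (skeleton x ω k : Fin d → ℤ) 0).natAbs ≤ 1 := fun k => natAbs_move_sub_le _ _ 0
  simp only [rightSites, leftSites, rightHalf, leftHalf, Set.mem_ofPred_eq] at hside
  refine (hside K le_rfl).imp (fun h0 => ?_) fun h0 => ?_
  · refine eventually_atTop.2 ⟨K, fun k hk => ?_⟩
    change (n : ℤ) ≤ (skeleton x ω k : Fin d → ℤ) 0
    induction k, hk using Nat.le_induction with
    | base => exact h0
    | succ k hk ih =>
      have h1 := hstep k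
      have h2 := hside (k + 1) (by omega)
      omega
  · refine eventually_atTop.2 ⟨K, fun k hk => ?_⟩
    change (skeleton x ω k : Fin d → ℤ) 0 ≤ -(n : ℤ)
    induction k, hk using Nat.le_induction with
    | base => exact h0
    | succ k hk ih =>
      have h1 := hstep k
      have h2 := hside (k + 1) (by omega)
      omega

lemma pPlus_add_pMinus (hd : 3 ≤ d) (hn : 1 ≤ n) (x : domain d n) : pPlus x + pMinus x = 1 := by
  rw [pPlus_eq, pMinus_eq, ← measureReal_union
    (disjoint_eventuallyIn (disjoint_rightSites_leftSites hn) x) (measurableSet_eventuallyIn x _)]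
  have h : (sampleMeasure d).real
      (eventuallyIn x (rightSites d n) ∪ eventuallyIn x (leftSites d n)) =
        (sampleMeasure d).real Set.univ := by
    refine measureReal_congr ?_
    filter_upwards [ae_eventuallyIn_or hd hn x] with ω hω
    exact propext (iff_true_right trivial |>.2 hω)
  rw [h, probReal_univ]

/-- If the walk ends up in one of two disjoint sets, then the probability of ending up in `A` is
the limit of the probabilities of being in `A`. -/
lemma tendsto_measureReal_skeleton_inter {x : domain d n} {A B : Set (domain d n)}
    (hAB : Disjoint A B)
    (h : ∀ᵐ ω ∂sampleMeasure d, ω ∈ eventuallyIn x A ∨ ω ∈ eventuallyIn x B)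
    {E : Set (Sample d)} (hE : MeasurableSet E) (hAE : eventuallyIn x A ⊆ E) :
    Tendsto (fun k => (sampleMeasure d).real ({ω | skeleton x ω k ∈ A} ∩ E)) atTop
      (𝓝 ((sampleMeasure d).real (eventuallyIn x A))) := by
  refine (ENNReal.tendsto_toReal (measure_ne_top _ _)).comp
    (tendsto_measure_of_ae_tendsto_indicator_of_isFiniteMeasure atTop
      (measurableSet_eventuallyIn x A)
      (fun k => (measurableSet_skeleton_mem x k A).inter hE) ?_)
  filter_upwards [h] with ω hω
  rcases hω with hA | hB
  · filter_upwards [hA] with k hk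
    exact iff_of_true ⟨hk, hAE hA⟩ hA
  · have hnA : ω ∉ eventuallyIn x A := fun hA =>
      Set.disjoint_left.1 (disjoint_eventuallyIn hAB x) hA hB
    filter_upwards [hB] with k hk
    exact iff_of_false (fun hk' => Set.disjoint_left.1 hAB hk'.1 hk) hnA

lemma tendsto_skeletonProb {x : domain d n} {A B : Set (domain d n)} (hAB : Disjoint A B)
    (h : ∀ᵐ ω ∂sampleMeasure d, ω ∈ eventuallyIn x A ∨ ω ∈ eventuallyIn x B) :
    Tendsto (fun k => skeletonProb A k x) atTop
      (𝓝 ((sampleMeasure d).real (eventuallyIn x A))) := by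
  simpa only [Set.inter_univ, skeletonProb] using
    tendsto_measureReal_skeleton_inter hAB h MeasurableSet.univ (Set.subset_univ _)

end Escape

/-! ### Reflection symmetry -/

section Reflection

variable {d n : ℕ} [NeZero d]

/-- Reflection of `ℤ^d` in the first coordinate. -/
def reflectVec (x : Fin d → ℤ) : Fin d → ℤ := Function.update x 0 (-x 0)

lemma reflectVec_mem {x : Fin d → ℤ} (hx : x ∈ domain d n) : reflectVec x ∈ domain d n := by
  rcases hx with (hr | hc) | hl
  · refine Or.inr ?_
    have : (n : ℤ) ≤ x 0 := hr
    simpa [leftHalf, reflectVec] using this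
  · refine Or.inl (Or.inr fun i => ?_)
    by_cases hi : i = 0
    · subst hi; simpa [reflectVec] using hc 0
    · simpa [reflectVec, hi] using hc i
  · refine Or.inl (Or.inl ?_)
    have : x 0 ≤ -(n : ℤ) := hl
    simp only [rightHalf, reflectVec, Set.mem_ofPred_eq, Function.update_self]
    omega

lemma reflectVec_reflectVec (x : Fin d → ℤ) : reflectVec (reflectVec x) = x := by
  simp [reflectVec]

/-- Reflection of the domain in the first coordinate. -/
def reflect (x : domain d n) : domain d n := ⟨reflectVec x, reflectVec_mem x.2⟩

/-- Reflection of the directions in the first coordinate. -/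
def reflectDir (e : Direction d) : Direction d := (e.1, if e.1 = 0 then !e.2 else e.2)

lemma reflectDir_involutive : Function.Involutive (reflectDir (d := d)) := by
  rintro ⟨i, b⟩
  by_cases hi : i = 0 <;> simp [reflectDir, hi]

lemma reflectVec_add_vec (x : Fin d → ℤ) (e : Direction d) :
    reflectVec x + (reflectDir e).vec = reflectVec (x + e.vec) := by
  obtain ⟨i, b⟩ := e
  ext j
  by_cases hi : i = 0
  · subst hi
    by_cases hj : j = 0
    · subst hj
      cases b <;> simp [reflectVec, reflectDir, Direction.vec] <;> ring
    · simp [reflectVec, reflectDir, Direction.vec, hj]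
  · by_cases hj : j = 0
    · subst hj
      simp [reflectVec, reflectDir, Direction.vec, hi, Ne.symm hi]
    · simp [reflectVec, reflectDir, Direction.vec, hi, hj]

lemma move_reflect (x : domain d n) (e : Direction d) :
    move (reflect x) (reflectDir e) = reflect (move x e) := by
  by_cases h : (x : Fin d → ℤ) + e.vec ∈ domain d n
  · have h' : (reflect x : Fin d → ℤ) + (reflectDir e).vec ∈ domain d n := by
      rw [reflect, reflectVec_add_vec]; exact reflectVec_mem h
    rw [move_of_mem h, move_of_mem h']
    exact Subtype.ext (reflectVec_add_vec _ _)
  · have h' : (reflect x : Fin d → ℤ) + (reflectDir e).vec ∉ domain d n := by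
      rw [reflect, reflectVec_add_vec]
      intro hm
      have := reflectVec_mem hm
      rw [reflectVec_reflectVec] at this
      exact h this
    rw [move_of_notMem h, move_of_notMem h']

/-- At a fixed ring, symmetry follows from the backward equation by reindexing directions, with no
map on sample paths. `pPlus_center` then passes to the limit. -/
lemma skeletonProb_reflect (k : ℕ) (x : domain d n) :
    skeletonProb (rightSites d n) k (reflect x) = skeletonProb (leftSites d n) k x := by
  induction k generalizing x with
  | zero =>
    rw [skeletonProb_zero, skeletonProb_zero]
    have h : reflect x ∈ rightSites d n ↔ x ∈ leftSites d n := by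
      simp only [rightSites, leftSites, rightHalf, leftHalf, Set.mem_ofPred_eq, reflect,
        reflectVec, Function.update_self]
      omega
    by_cases hx : x ∈ leftSites d n
    · rw [if_pos hx, if_pos (h.2 hx)]
    · rw [if_neg hx, if_neg (mt h.1 hx)]
  | succ k ih =>
    refine mul_left_cancel₀ (two_mul_pos d).ne' ?_
    rw [← sum_skeletonProb, ← sum_skeletonProb,
      ← Equiv.sum_comp (reflectDir_involutive (d := d)).toPerm]
    refine Finset.sum_congr rfl fun e _ => ?_
    rw [← ih, ← move_reflect]
    rfl

/-- The centre of the channel. -/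
def center (d n : ℕ) [NeZero d] : domain d n := ⟨0, Or.inl (Or.inr fun i => by simp)⟩

lemma reflect_center : reflect (center d n) = center d n :=
  Subtype.ext (by simp [reflect, center, reflectVec])

lemma pPlus_center (hd : 3 ≤ d) (hn : 1 ≤ n) : pPlus (center d n) = 1 / 2 := by
  have hor := ae_eventuallyIn_or hd hn (center d n)
  have hdis := disjoint_rightSites_leftSites (d := d) hn
  have h1 := tendsto_skeletonProb hdis hor
  have h2 := tendsto_skeletonProb hdis.symm (hor.mono fun _ => Or.symm)
  rw [← pPlus_eq] at h1
  rw [← pMinus_eq] at h2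
  have h3 : pPlus (center d n) = pMinus (center d n) := by
    refine tendsto_nhds_unique h1 (h2.congr fun k => ?_)
    rw [← skeletonProb_reflect, reflect_center]
  have h4 := pPlus_add_pMinus hd hn (center d n)
  linarith

end Reflection

/-! ### Non-constancy by a zero-one argument -/

section Nonconstant

variable {d n : ℕ} [NeZero d]

/-- If the probability of ending up in `A` does not depend on the starting point, then ending up in
`A` is independent of the position at any given ring. -/
lemma measureReal_skeleton_inter_eventuallyIn {A : Set (domain d n)} {c : ℝ}
    (hc : ∀ x : domain d n, (sampleMeasure d).real (eventuallyIn x A) = c) (k : ℕ)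
    (x : domain d n) :
    (sampleMeasure d).real ({ω | skeleton x ω k ∈ A} ∩ eventuallyIn x A) =
      c * skeletonProb A k x := by
  induction k generalizing x with
  | zero =>
    rw [skeletonProb_zero]
    by_cases h : x ∈ A <;> simp [skeleton, h, hc]
  | succ k ih =>
    refine mul_left_cancel₀ (two_mul_pos d).ne' ?_
    rw [mul_left_comm, ← sum_skeletonProb, Finset.mul_sum]
    simp only [← ih]
    rw [← sampleMeasure_firstStep fun e => (measurableSet_skeleton_mem (move x e) k A).inter
      (measurableSet_eventuallyIn (move x e) A), eventuallyIn_eq x A]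
    simp only [skeleton_succ]
    rfl

lemma exists_pPlus_ne (hd : 3 ≤ d) (hn : 1 ≤ n) :
    ∃ x : domain d n, pPlus x ≠ pPlus (center d n) := by
  by_contra! h
  have hhalf := pPlus_center (n := n) hd hn
  have hc : ∀ x : domain d n, (sampleMeasure d).real (eventuallyIn x (rightSites d n)) = 1 / 2 :=
    fun x => by rw [← pPlus_eq, h, hhalf]
  have hor := ae_eventuallyIn_or hd hn (center d n)
  have hdis := disjoint_rightSites_leftSites (d := d) hn
  have h1 := tendsto_measureReal_skeleton_inter hdis hor (measurableSet_eventuallyIn _ _) subset_rfl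
  have h2 := (tendsto_skeletonProb hdis hor).const_mul (1 / 2)
  simp only [measureReal_skeleton_inter_eventuallyIn hc] at h1
  -- The same sequence tends to `1 / 2`, the probability of the eventual event, and to `1 / 2` times
  -- that probability.
  have h3 := tendsto_nhds_unique h1 h2
  rw [hc] at h3
  norm_num at h3

lemma exists_lam_ne (hd : 3 ≤ d) (hn : 1 ≤ n) {lm lp : ℝ} (hl : lm < lp) :
    ∃ x y : domain d n, lam lm lp x ≠ lam lm lp y := by
  obtain ⟨x, hx⟩ := exists_pPlus_ne (n := n) hd hn
  refine ⟨x, center d n, fun h => hx ?_⟩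
  have h1 := pPlus_add_pMinus hd hn x
  have h2 := pPlus_add_pMinus hd hn (center d n)
  have h3 : (lp - lm) * (pPlus x - pPlus (center d n)) = 0 := by
    unfold lam at h
    rw [← eq_sub_iff_add_eq'] at h1 h2
    rw [h1, h2] at h
    linarith
  rcases mul_eq_zero.1 h3 with h4 | h4 <;> linarith

end Nonconstant

end ChannelWalk

theorem mainTheorem3 (d : ℕ) [NeZero d] (lm lp : ℝ) (hl : lm < lp) :
    (∀ n : ℕ, 1 ≤ n →
      ((∃ M : ℝ, ∀ x : ChannelWalk.domain d n, |ChannelWalk.lam lm lp x| ≤ M) ∧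
        ChannelWalk.IsHarmonic (fun x : ChannelWalk.domain d n => ChannelWalk.lam lm lp x)) ∧
      (3 ≤ d →
        (∀ x : ChannelWalk.domain d n, ChannelWalk.pPlus x + ChannelWalk.pMinus x = 1) ∧
        ∃ x y : ChannelWalk.domain d n, ChannelWalk.lam lm lp x ≠ ChannelWalk.lam lm lp y) ∧
      (∀ ξ η : ℤ, |ξ| < (n : ℤ) → |η| < (n : ℤ) →
        ChannelWalk.flux (fun x : ChannelWalk.domain d n => ChannelWalk.lam lm lp x) ξ =
          ChannelWalk.flux (fun x : ChannelWalk.domain d n => ChannelWalk.lam lm lp x) η)) ∧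
    (∃ c : ℝ, 0 < c ∧ ∀ n : ℕ, 1 ≤ n → ∀ ξ : ℤ, |ξ| < (n : ℤ) →
      |ChannelWalk.flux (fun x : ChannelWalk.domain d n => ChannelWalk.lam lm lp x) ξ| /
        (n : ℝ) ^ (d - 1) ≤ c / (n : ℝ)) := by
  refine ⟨fun n hn => ⟨⟨⟨|lm| + |lp|, ChannelWalk.abs_lam_le lm lp⟩,
    ChannelWalk.isHarmonic_lam lm lp⟩, fun hd => ⟨ChannelWalk.pPlus_add_pMinus hd hn,
    ChannelWalk.exists_lam_ne hd hn hl⟩, fun ξ η hξ hη => ?_⟩,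
    2 * (|lm| + |lp|) * 3 ^ (d - 1), ?_, fun n hn ξ hξ => ?_⟩
  · rw [ChannelWalk.flux_eq_flux_zero (ChannelWalk.isHarmonic_lam lm lp) hξ,
      ChannelWalk.flux_eq_flux_zero (ChannelWalk.isHarmonic_lam lm lp) hη]
  -- Since `lm < lp`, the two cannot both vanish.
  · have h : 0 < |lm| + |lp| := by
      rcases eq_or_ne lm 0 with h0 | h0
      · have : 0 < |lp| := abs_pos.2 (by linarith)
        linarith [abs_nonneg lm]
      · linarith [abs_pos.2 h0, abs_nonneg lp]
    positivity
  · exact ChannelWalk.abs_flux_div_le (ChannelWalk.isHarmonic_lam lm lp) hn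
      (ChannelWalk.abs_lam_le lm lp) hξ
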